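/- Let $k$ be a field, $k\times k$ the product algebra, $1=(1,1)$ and $e=(1,0)$. For a Hopf algebra $H$ over $k$, an $H$-action on a $k$-algebra $A$ is a linear map $\psi\colon H\otimes A\to A$ making $A$ a left $H$-module with $h(ab)=(h_{(1)}a)(h_{(2)}b)$; it is unital if $h1_A=\varepsilon(h)1_A$. Its cosupport is the subalgebra $\operatorname{cosupp}\psi=\{\psi(h\otimes -)\mid h\in H\}\subseteq\operatorname{End}_k(A)$. Two actions on $A$ are equivalent via an algebra automorphism $\varphi$ of $A$ if $f\mapsto\varphi f\varphi^{-1}$ maps one cosupport onto the other; so they are equivalent via $\mathrm{id}_A$ if their cosupports coincide. For a unital subalgebra $V\subseteq\operatorname{End}_k(A)$, a pair $(H_0,\psi_0)$ of a Hopf algebra and an action on $A$ is $V$-universal if $\operatorname{cosupp}\psi_0\subseteq V$ and for every Hopf algebra $H$ and every $H$-action $\psi$ on $A$ with $\operatorname{cosupp}\psi\subseteq V$ there is a unique Hopf algebra homomorphism $\varphi\colon H\to H_0$ with $\psi_0(\varphi\otimes\mathrm{id}_A)=\psi$. Let $\mathcal M=k\langle c,d,h\rangle/(cd-1,\ dc-1,\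 h^2-h,\ hc+ch+c^2-c)$ be the Hopf algebra with $\Delta c=c\otimes c$, $\Delta d=d\otimes d$, $\Delta h=h\otimes c+1\otimes h$, $\varepsilon(c)=\varepsilon(d)=1$, $\varepsilon(h)=0$, $Sc=d$, $Sd=c$, $Sh=-hd$, and let $\rho_3\colon k\times k\to(k\times k)\otimes\mathcal M$ be the unital coaction with $\rho_3(e)=1\otimes h+e\otimes c$ (the Manin coaction). Let $\mathcal M^\circ$ be the finite dual of $\mathcal M$: the Hopf algebra of all linear functions on $\mathcal M$ that vanish on a two-sided ideal of finite codimension. Then every unital Hopf algebra action on $k\times k$ is equivalent, via $\mathrm{id}_{k\times k}$, to one of the following three unital actions. 1. $\psi_1\colon k\otimes(k\times k)\to k\times k$, $\psi_1(\lambda\otimes a)=\lambda a$. Its cosupport is one-dimensional and consists of all scalar operators. 2. $\psi_2\colon kC_2\otimes(k\times k)\to k\times k$, $C_2=\langle c\rangle$ of order two, with $c(\alpha,\beta)=(\beta,\alpha)$. Its cosupport is two-dimensional. If $\operatorname{char}k\ne2$, it consists of all operators with diagonal matrix in the basis $(1,1),(1,-1)$; if $\operatorname{char}k=2$, it consists of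 all operators with matrix of the form $\begin{pmatrix}\alpha&\beta\\0&\alpha\end{pmatrix}$, $\alpha,\beta\in k$, in the basis $1,e$. 3. $\psi_3\colon\mathcal M^\circ\otimes(k\times k)\to k\times k$, the action dual to $\rho_3$: $\psi_3(\lambda\otimes a)=\lambda(a_{(1)})a_{(0)}$ where $\rho_3(a)=a_{(0)}\otimes a_{(1)}$. Its cosupport is three-dimensional and consists of all operators with upper triangular matrix in the basis $1,e$. If $\operatorname{char}k\neq2$, then $\psi_3$ is equivalent via $\mathrm{id}_{k\times k}$ to the unital action $\psi_{3a}$ of the Sweedler algebra $H_4$ with $c(\alpha,\beta)=(\beta,\alpha)$ and $v(\alpha,\beta)=(\alpha-\beta,\alpha-\beta)$. Here $H_4$ is generated by $c,v$ with $c^2=1$, $v^2=0$, $vc=-cv$, $\Delta c=c\otimes c$, $\Delta v=c\otimes v+v\otimes1$, $\varepsilon(c)=1$, $\varepsilon(v)=0$, $Sc=c$, $Sv=-cv$. Finally, $(k,\psi_1)$, $(kC_2,\psi_2)$ and $(\mathcal M^\circ,\psi_3)$ are $(\operatorname{cosupp}\psi_i)$-universal for $i=1,2,3$ respectively. -/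

import Mathlib

open scoped TensorProduct

universe u v w

noncomputable section

namespace HopfSym

/-! ### Actions, coactions, cosupports, equivalence and universality -/

/-- An `H`-action on the `k`-algebra `A`: a left `H`-module structure `act` on `A` with
`h (a b) = (h₁ a) (h₂ b)`, where `Δ h = h₁ ⊗ h₂`. The map `H ⊗ A → A` is `h ⊗ a ↦ act h a`. -/
structure HopfAction (k : Type*) [Field k] (H : Type*) [Semiring H] [HopfAlgebra k H]
    (A : Type*) [Ring A] [Algebra k A] where
  act : H →ₐ[k] Module.End k A
  act_mul : ∀ (h : H) (a b : A), act h (a * b) =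
    LinearMap.mul' k A (TensorProduct.homTensorHomMap (RingHom.id k) A A A A
      (TensorProduct.map act.toLinearMap act.toLinearMap (Coalgebra.comul h)) (a ⊗ₜ[k] b))

namespace HopfAction

variable {k : Type*} [Field k] {A : Type*} [Ring A] [Algebra k A]

/-- The action is unital: `h 1 = ε(h) 1`. -/
def IsUnital {H : Type*} [Semiring H] [HopfAlgebra k H] (ψ : HopfAction k H A) : Prop :=
  ∀ h : H, ψ.act h 1 = Coalgebra.counit (R := k) h • (1 : A)

/-- The cosupport of an action: the unital subalgebra `{ψ(h ⊗ -) | h ∈ H}` of `End_k(A)`. -/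
def cosupp {H : Type*} [Semiring H] [HopfAlgebra k H] (ψ : HopfAction k H A) :
    Subalgebra k (Module.End k A) :=
  ψ.act.range

/-- The algebra isomorphism `φ : A₁ ≃ A₂` is an equivalence of the actions `ψ₁`, `ψ₂`: the
isomorphism `f ↦ φ f φ⁻¹` of endomorphism algebras maps `cosupp ψ₁` onto `cosupp ψ₂`. -/
def IsEquivalence {H₁ H₂ : Type*} [Semiring H₁] [HopfAlgebra k H₁]
    [Semiring H₂] [HopfAlgebra k H₂] {A₁ A₂ : Type*} [Ring A₁] [Algebra k A₁]
    [Ring A₂] [Algebra k A₂] (ψ₁ : HopfAction k H₁ A₁) (ψ₂ : HopfAction k H₂ A₂)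
    (φ : A₁ ≃ₐ[k] A₂) : Prop :=
  ψ₁.cosupp.map (φ.toLinearEquiv.conjAlgEquiv k).toAlgHom = ψ₂.cosupp

/-- `(H₀, ψ₀)` is a `V`-universal acting Hopf algebra, tested against all Hopf algebras in the
universe `w`. A bialgebra homomorphism `→ₐc` of Hopf algebras automatically commutes with the
antipodes, i.e. it is a Hopf algebra homomorphism. -/
def IsUniversal {H₀ : Type*} [Semiring H₀] [HopfAlgebra k H₀] (ψ₀ : HopfAction k H₀ A)
    (V : Subalgebra k (Module.End k A)) : Prop :=
  ψ₀.cosupp ≤ V ∧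
    ∀ (H : Type w) [Ring H] [HopfAlgebra k H] (ψ : HopfAction k H A), ψ.cosupp ≤ V →
      ∃! φ : H →ₐc[k] H₀, ∀ (h : H) (a : A), ψ₀.act (φ h) a = ψ.act h a

end HopfAction

/-- An `H`-coaction on the `k`-algebra `A`: a right `H`-comodule structure which is
multiplicative. -/
structure HopfCoaction (k : Type*) [Field k] (H : Type*) [Ring H] [HopfAlgebra k H]
    (A : Type*) [Ring A] [Algebra k A] where
  coact : A →ₗ[k] A ⊗[k] H
  map_mul : ∀ a b : A, coact (a * b) = coact a * coact b
  coassoc : ∀ a : A, (Coalgebra.comul (R := k) (A := H)).lTensor A (coact a) =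
    TensorProduct.assoc k A H H (coact.rTensor H (coact a))
  counit : ∀ a : A, (Coalgebra.counit (R := k) (A := H)).lTensor A (coact a) = a ⊗ₜ[k] (1 : k)

/-- For a linear map `ρ : A → B ⊗ Q`, the map `ρ^∨ : Q* ⊗ A → B`, written as
`Q* → Hom(A, B)`: if `ρ(a) = ∑ bᵢ ⊗ qᵢ`, then `ρ^∨(l ⊗ a) = ∑ l(qᵢ) bᵢ`. -/
def checkMap {k A B Q : Type*} [Field k] [AddCommGroup A] [Module k A] [AddCommGroup B]
    [Module k B] [AddCommGroup Q] [Module k Q] (ρ : A →ₗ[k] B ⊗[k] Q) :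
    Module.Dual k Q →ₗ[k] A →ₗ[k] B :=
  (LinearMap.lcomp k B ρ) ∘ₗ
    ((TensorProduct.rid k B).toLinearMap.compRight k) ∘ₗ LinearMap.lTensorHom B

lemma checkMap_apply {k A B Q : Type*} [Field k] [AddCommGroup A] [Module k A] [AddCommGroup B]
    [Module k B] [AddCommGroup Q] [Module k Q] (ρ : A →ₗ[k] B ⊗[k] Q) (l : Module.Dual k Q)
    (a : A) : checkMap ρ l a = TensorProduct.rid k B (l.lTensor B (ρ a)) := rfl

/-! ### The finite (Sweedler) dual -/

section FiniteDual

variable (k : Type u) [Field k] (H : Type v) [Ring H]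

/-- `l` vanishes on a two-sided ideal of finite codimension. -/
def VanishesCofinitely [Algebra k H] (l : Module.Dual k H) : Prop :=
  ∃ (I : Ideal H) (_ : I.IsTwoSided), FiniteDimensional k (H ⧸ I) ∧ ∀ x ∈ I, l x = 0

variable {k H}

lemma vanishesCofinitely_of_factor [Algebra k H] {B : Type*} [Ring B] [Algebra k B]
    [FiniteDimensional k B] (f : H →ₐ[k] B) (g : B →ₗ[k] k) :
    VanishesCofinitely k H (g ∘ₗ f.toLinearMap) := by
  refine ⟨RingHom.ker f, inferInstance, ?_, ?_⟩
  · exact Module.Finite.of_injective (Ideal.kerLiftAlg f).toLinearMap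
      (Ideal.kerLiftAlg_injective f)
  · intro x hx
    have : f x = 0 := hx
    simp [this]

lemma VanishesCofinitely.factor [Algebra k H] {l : Module.Dual k H}
    (hl : VanishesCofinitely k H l) :
    ∃ (I : Ideal H) (_ : I.IsTwoSided) (_ : FiniteDimensional k (H ⧸ I))
      (g : (H ⧸ I) →ₗ[k] k), l = g ∘ₗ (Ideal.Quotient.mkₐ k I).toLinearMap := by
  obtain ⟨I, hI, hfin, h0⟩ := hl
  refine ⟨I, hI, hfin, (I.restrictScalars k).liftQ l h0, ?_⟩
  ext x
  rfl

variable (k H)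

/-- The finite dual `H°` of a Hopf algebra `H`, as a subalgebra of `H*` with the convolution
product `(l m)(x) = l(x₁) m(x₂)`: the functionals vanishing on a two-sided ideal of finite
codimension. -/
def finiteDual [HopfAlgebra k H] : Subalgebra k (WithConv (Module.Dual k H)) where
  carrier := {l | VanishesCofinitely k H l.ofConv}
  mul_mem' := by
    rintro l m hl hm
    obtain ⟨I, hI, hIf, g, hg⟩ := VanishesCofinitely.factor hl
    obtain ⟨J, hJ, hJf, g', hg'⟩ := VanishesCofinitely.factor hm
    have := vanishesCofinitely_of_factor
      ((Algebra.TensorProduct.map (Ideal.Quotient.mkₐ k I) (Ideal.Quotient.mkₐ k J)).comp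
        (Bialgebra.comulAlgHom k H)) (LinearMap.mul' k k ∘ₗ TensorProduct.map g g')
    convert this using 1
    rw [LinearMap.convMul_def, hg, hg', TensorProduct.map_comp]
    rfl
  add_mem' := by
    rintro l m hl hm
    obtain ⟨I, hI, hIf, g, hg⟩ := VanishesCofinitely.factor hl
    obtain ⟨J, hJ, hJf, g', hg'⟩ := VanishesCofinitely.factor hm
    have := vanishesCofinitely_of_factor
      ((Ideal.Quotient.mkₐ k I).prod (Ideal.Quotient.mkₐ k J)) (g.coprod g')
    change VanishesCofinitely k H (l.ofConv + m.ofConv)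
    convert this using 1
    rw [hg, hg']
    ext x
    simp
  algebraMap_mem' := by
    intro r
    have := vanishesCofinitely_of_factor (Bialgebra.counitAlgHom k H) (r • LinearMap.id)
    change VanishesCofinitely k H (algebraMap k (WithConv (Module.Dual k H)) r).ofConv
    convert this using 1
    ext x
    simp

/-- The finite dual `H°` as a type. -/
def FiniteDual [HopfAlgebra k H] : Type (max u v) := finiteDual k H

instance [HopfAlgebra k H] : Ring (FiniteDual k H) := inferInstanceAs (Ring (finiteDual k H))

instance [HopfAlgebra k H] : Algebra k (FiniteDual k H) :=
  inferInstanceAs (Algebra k (finiteDual k H))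

/-- The embedding `ϰ : H° → H*`. -/
def finiteDualIncl [HopfAlgebra k H] : FiniteDual k H →ₗ[k] Module.Dual k H :=
  (WithConv.linearEquiv k (Module.Dual k H)).toLinearMap ∘ₗ (finiteDual k H).val.toLinearMap

lemma finiteDualIncl_injective [HopfAlgebra k H] : Function.Injective (finiteDualIncl k H) :=
  (WithConv.linearEquiv k (Module.Dual k H)).injective.comp Subtype.val_injective

variable {k H}

lemma dualDistrib_injective (V W : Type*) [AddCommGroup V] [Module k V] [AddCommGroup W]
    [Module k W] : Function.Injective (TensorProduct.dualDistrib k V W) := by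
  classical
  rw [injective_iff_map_eq_zero]
  intro t ht
  let b := Module.Basis.ofVectorSpace k (Module.Dual k W)
  apply (TensorProduct.equivFinsuppOfBasisRight (M := Module.Dual k V) b).injective
  rw [map_zero]
  ext i x
  have key : ∀ t : Module.Dual k V ⊗[k] Module.Dual k W,
      TensorProduct.equivFinsuppOfBasisRight b t i x =
        b.repr (TensorProduct.lid k _ ((Module.Dual.eval k V x).rTensor _ t)) i := by
    intro t
    induction t with
    | zero => simp
    | add t s ht hs => simp [ht, hs]
    | tmul l m => simp [mul_comm]
  have key2 : ∀ (t : Module.Dual k V ⊗[k] Module.Dual k W) (y : W),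
      TensorProduct.lid k _ ((Module.Dual.eval k V x).rTensor _ t) y =
        TensorProduct.dualDistrib k V W t (x ⊗ₜ y) := by
    intro t y
    induction t with
    | zero => simp
    | add t s ht hs => simp [ht, hs]
    | tmul l m => simp
  have h0 : TensorProduct.lid k _ ((Module.Dual.eval k V x).rTensor _ t) = 0 := by
    ext y
    rw [key2, ht]
    rfl
  rw [key, h0]
  simp

lemma dualDistrib_map_injective {D E V W : Type*} [AddCommGroup V] [Module k V] [AddCommGroup W]
    [Module k W] [AddCommGroup D] [Module k D] [AddCommGroup E] [Module k E]
    {f : D →ₗ[k] Module.Dual k V} {g : E →ₗ[k] Module.Dual k W}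
    (hf : Function.Injective f) (hg : Function.Injective g) :
    Function.Injective (TensorProduct.dualDistrib k V W ∘ₗ TensorProduct.map f g) := by
  rw [LinearMap.coe_comp]
  exact (dualDistrib_injective V W).comp (TensorProduct.map_injective_of_flat_flat f g hf hg)

variable (k H)
variable [HopfAlgebra k H]

/-- The embedding `H° ⊗ H° → (H ⊗ H)*`. -/
def pair₂ : FiniteDual k H ⊗[k] FiniteDual k H →ₗ[k] Module.Dual k (H ⊗[k] H) :=
  TensorProduct.dualDistrib k H H ∘ₗ
    TensorProduct.map (finiteDualIncl k H) (finiteDualIncl k H)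

lemma pair₂_injective : Function.Injective (pair₂ k H) :=
  dualDistrib_map_injective (finiteDualIncl_injective k H) (finiteDualIncl_injective k H)

variable {k H}

@[simp] lemma pair₂_tmul (l m : FiniteDual k H) (x y : H) :
    pair₂ k H (l ⊗ₜ m) (x ⊗ₜ y) = finiteDualIncl k H l x * finiteDualIncl k H m y := rfl

lemma comp_mul_mem_range (l : FiniteDual k H) :
    finiteDualIncl k H l ∘ₗ LinearMap.mul' k H ∈ LinearMap.range (pair₂ k H) := by
  obtain ⟨I, hI, hIf, g, hg⟩ := VanishesCofinitely.factor l.2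
  let q := Ideal.Quotient.mkₐ k I
  let j : Module.Dual k (H ⧸ I) →ₗ[k] FiniteDual k H :=
    { toFun := fun f => ⟨WithConv.toConv (f ∘ₗ q.toLinearMap), vanishesCofinitely_of_factor q f⟩
      map_add' := fun _ _ => rfl
      map_smul' := fun _ _ => rfl }
  obtain ⟨t, ht⟩ := (TensorProduct.dualDistribEquiv k (H ⧸ I) (H ⧸ I)).surjective
    (g ∘ₗ LinearMap.mul' k (H ⧸ I))
  refine ⟨TensorProduct.map j j t, ?_⟩
  have key : ∀ t : Module.Dual k (H ⧸ I) ⊗[k] Module.Dual k (H ⧸ I),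
      pair₂ k H (TensorProduct.map j j t) =
        TensorProduct.dualDistrib k _ _ t ∘ₗ TensorProduct.map q.toLinearMap q.toLinearMap := by
    intro t
    induction t with
    | zero => simp
    | add t s ht hs => simp only [map_add, ht, hs, LinearMap.add_comp]
    | tmul a b =>
      ext x y
      rfl
  have ht' : TensorProduct.dualDistrib k _ _ t = g ∘ₗ LinearMap.mul' k (H ⧸ I) := ht
  rw [key, ht']
  have hl : finiteDualIncl k H l = g ∘ₗ q.toLinearMap := hg
  rw [hl]
  ext x y
  simp

variable (k H)

/-- The comultiplication of `H°`: `Δ l` is the element of `H° ⊗ H°` with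
`(Δ l)(x ⊗ y) = l(x y)`. -/
def finiteDualComul : FiniteDual k H →ₗ[k] FiniteDual k H ⊗[k] FiniteDual k H :=
  (LinearEquiv.ofInjective (pair₂ k H) (pair₂_injective k H)).symm.toLinearMap ∘ₗ
    (((LinearMap.lcomp k k (LinearMap.mul' k H)) ∘ₗ finiteDualIncl k H).codRestrict
      (LinearMap.range (pair₂ k H)) comp_mul_mem_range)

variable {k H}

lemma pair₂_finiteDualComul (l : FiniteDual k H) :
    pair₂ k H (finiteDualComul k H l) = finiteDualIncl k H l ∘ₗ LinearMap.mul' k H := by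
  have := LinearEquiv.ofInjective_symm_apply (f := pair₂ k H) (h := pair₂_injective k H)
    ⟨_, comp_mul_mem_range l⟩
  exact this

lemma pair₂_finiteDualComul_apply (l : FiniteDual k H) (x y : H) :
    pair₂ k H (finiteDualComul k H l) (x ⊗ₜ y) = finiteDualIncl k H l (x * y) := by
  rw [pair₂_finiteDualComul]; simp

variable (k H)

/-- The counit of `H°`: evaluation at `1`. -/
def finiteDualCounit : FiniteDual k H →ₗ[k] k :=
  Module.Dual.eval k H 1 ∘ₗ finiteDualIncl k H

instance finiteDualCoalgebra : Coalgebra k (FiniteDual k H) where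
  comul := finiteDualComul k H
  counit := finiteDualCounit k H
  coassoc := by
    apply LinearMap.ext
    intro l
    apply dualDistrib_map_injective (finiteDualIncl_injective k H) (pair₂_injective k H)
    have h1 : ∀ (t : FiniteDual k H ⊗[k] FiniteDual k H) (x y z : H),
        (TensorProduct.dualDistrib k H (H ⊗[k] H) ∘ₗ
          TensorProduct.map (finiteDualIncl k H) (pair₂ k H))
          (TensorProduct.assoc k _ _ _ ((finiteDualComul k H).rTensor _ t)) (x ⊗ₜ (y ⊗ₜ z)) =
        pair₂ k H t ((x * y) ⊗ₜ z) := by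
      intro t x y z
      induction t with
      | zero => simp
      | add t s ht hs => simp only [map_add, LinearMap.add_apply, ht, hs]
      | tmul a b =>
        rw [LinearMap.rTensor_tmul, pair₂_tmul, ← pair₂_finiteDualComul_apply]
        generalize finiteDualComul k H a = r
        induction r with
        | zero => simp
        | add t s ht hs => simp only [TensorProduct.add_tmul, map_add, LinearMap.add_apply, ht, hs,
            add_mul]
        | tmul c d => simp [mul_assoc]
    have h2 : ∀ (t : FiniteDual k H ⊗[k] FiniteDual k H) (x y z : H),
        (TensorProduct.dualDistrib k H (H ⊗[k] H) ∘ₗ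
          TensorProduct.map (finiteDualIncl k H) (pair₂ k H))
          ((finiteDualComul k H).lTensor _ t) (x ⊗ₜ (y ⊗ₜ z)) =
        pair₂ k H t (x ⊗ₜ (y * z)) := by
      intro t x y z
      induction t with
      | zero => simp
      | add t s ht hs => simp only [map_add, LinearMap.add_apply, ht, hs]
      | tmul a b =>
        rw [LinearMap.lTensor_tmul, pair₂_tmul, ← pair₂_finiteDualComul_apply]
        simp
    ext x y z
    simp only [TensorProduct.AlgebraTensorModule.curry_apply, LinearMap.restrictScalars_self,
      TensorProduct.curry_apply, LinearMap.coe_comp, Function.comp_apply, LinearEquiv.coe_coe]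
    refine (h1 _ x y z).trans (Eq.trans ?_ (h2 _ x y z).symm)
    rw [pair₂_finiteDualComul_apply, pair₂_finiteDualComul_apply, mul_assoc]
  rTensor_counit_comp_comul := by
    apply LinearMap.ext
    intro l
    apply (TensorProduct.lid k _).injective
    apply finiteDualIncl_injective
    ext y
    have h1 : ∀ t : FiniteDual k H ⊗[k] FiniteDual k H, finiteDualIncl k H
        (TensorProduct.lid k _ ((finiteDualCounit k H).rTensor _ t)) y =
          pair₂ k H t (1 ⊗ₜ y) := by
      intro t
      induction t with
      | zero => simp
      | add t s ht hs => simp only [map_add, LinearMap.add_apply, ht, hs]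
      | tmul a b => simp [finiteDualCounit]
    refine (h1 _).trans ?_
    rw [pair₂_finiteDualComul_apply]
    simp
  lTensor_counit_comp_comul := by
    apply LinearMap.ext
    intro l
    apply (TensorProduct.rid k _).injective
    apply finiteDualIncl_injective
    ext y
    have h1 : ∀ t : FiniteDual k H ⊗[k] FiniteDual k H, finiteDualIncl k H
        (TensorProduct.rid k _ ((finiteDualCounit k H).lTensor _ t)) y =
          pair₂ k H t (y ⊗ₜ 1) := by
      intro t
      induction t with
      | zero => simp
      | add t s ht hs => simp only [map_add, LinearMap.add_apply, ht, hs]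
      | tmul a b => simp [finiteDualCounit, mul_comm]
    refine (h1 _).trans ?_
    rw [pair₂_finiteDualComul_apply]
    simp

variable {k H}

lemma finiteDual_comul_eq : Coalgebra.comul (R := k) (A := FiniteDual k H) =
    finiteDualComul k H := rfl

lemma finiteDualIncl_mul (l m : FiniteDual k H) : finiteDualIncl k H (l * m) =
    LinearMap.mul' k k ∘ₗ TensorProduct.map (finiteDualIncl k H l) (finiteDualIncl k H m) ∘ₗ
      Coalgebra.comul := rfl

lemma finiteDualIncl_one : finiteDualIncl k H 1 = Coalgebra.counit := rfl

lemma pair₂_mul (t s : FiniteDual k H ⊗[k] FiniteDual k H) :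
    pair₂ k H (t * s) = LinearMap.mul' k k ∘ₗ
      TensorProduct.map (pair₂ k H t) (pair₂ k H s) ∘ₗ Coalgebra.comul := by
  induction t with
  | zero => ext; simp
  | add t t' ht ht' =>
    simp only [add_mul, map_add, TensorProduct.map_add_left, LinearMap.add_comp,
      LinearMap.comp_add, ht, ht']
  | tmul a b =>
    induction s with
    | zero => ext; simp
    | add t t' ht ht' =>
      simp only [mul_add, map_add, TensorProduct.map_add_right, LinearMap.add_comp,
        LinearMap.comp_add, ht, ht']
    | tmul c d =>
      ext x y
      simp only [Algebra.TensorProduct.tmul_mul_tmul, TensorProduct.AlgebraTensorModule.curry_apply,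
        LinearMap.restrictScalars_self, TensorProduct.curry_apply, pair₂_tmul, finiteDualIncl_mul,
        LinearMap.coe_comp, Function.comp_apply, TensorProduct.comul_tmul]
      generalize (Coalgebra.comul x : H ⊗[k] H) = r
      generalize (Coalgebra.comul y : H ⊗[k] H) = r'
      induction r with
      | zero => simp
      | add t t' ht ht' => simp only [TensorProduct.add_tmul, map_add, add_mul, ht, ht']
      | tmul p q =>
        induction r' with
        | zero => simp
        | add t t' ht ht' => simp only [TensorProduct.tmul_add, map_add, mul_add, ht, ht']
        | tmul p' q' => simp [mul_mul_mul_comm]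

instance finiteDualBialgebra : Bialgebra k (FiniteDual k H) :=
  Bialgebra.mk' k (FiniteDual k H)
    (by
      change finiteDualIncl k H 1 1 = 1
      rw [finiteDualIncl_one]
      simp)
    (by
      intro l m
      change finiteDualIncl k H (l * m) 1 = finiteDualIncl k H l 1 * finiteDualIncl k H m 1
      rw [finiteDualIncl_mul]
      simp [Algebra.TensorProduct.one_def])
    (by
      apply pair₂_injective
      rw [finiteDual_comul_eq, pair₂_finiteDualComul, Algebra.TensorProduct.one_def]
      ext x y
      simp [finiteDualIncl_one])
    (by
      intro l m
      apply pair₂_injective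
      rw [finiteDual_comul_eq, pair₂_mul, pair₂_finiteDualComul, pair₂_finiteDualComul,
        pair₂_finiteDualComul, finiteDualIncl_mul]
      have h := (Bialgebra.mulCoalgHom k H).map_comp_comul
      change TensorProduct.map (LinearMap.mul' k H) (LinearMap.mul' k H) ∘ₗ Coalgebra.comul =
        Coalgebra.comul ∘ₗ LinearMap.mul' k H at h
      rw [LinearMap.comp_assoc, LinearMap.comp_assoc, ← h, TensorProduct.map_comp]
      rfl)

variable (k H)

/-- The antipode of `H°`: `l ↦ l ∘ S`. -/
def finiteDualAntipode : FiniteDual k H →ₗ[k] FiniteDual k H where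
  toFun l := ⟨WithConv.toConv (finiteDualIncl k H l ∘ₗ HopfAlgebra.antipode k), by
    obtain ⟨I, hI, hIf, g, hg⟩ := VanishesCofinitely.factor l.2
    have := vanishesCofinitely_of_factor
      ((AlgHom.op (Ideal.Quotient.mkₐ k I)).comp (HopfAlgebra.antipodeAlgHomOp k H))
      (g ∘ₗ (MulOpposite.opLinearEquiv k).symm.toLinearMap)
    change VanishesCofinitely k H (finiteDualIncl k H l ∘ₗ HopfAlgebra.antipode k)
    have hl : finiteDualIncl k H l = g ∘ₗ (Ideal.Quotient.mkₐ k I).toLinearMap := hg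
    rw [hl]
    exact this⟩
  map_add' _ _ := rfl
  map_smul' _ _ := rfl

variable {k H}

lemma finiteDualIncl_antipode (l : FiniteDual k H) :
    finiteDualIncl k H (finiteDualAntipode k H l) =
      finiteDualIncl k H l ∘ₗ HopfAlgebra.antipode k := rfl

instance finiteDualHopfAlgebra : HopfAlgebra k (FiniteDual k H) where
  antipode := finiteDualAntipode k H
  mul_antipode_rTensor_comul := by
    apply LinearMap.ext
    intro l
    apply finiteDualIncl_injective
    ext x
    have h1 : ∀ t : FiniteDual k H ⊗[k] FiniteDual k H, finiteDualIncl k H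
        (LinearMap.mul' k _ ((finiteDualAntipode k H).rTensor _ t)) x =
          pair₂ k H t ((HopfAlgebra.antipode k).rTensor H (Coalgebra.comul x)) := by
      intro t
      induction t with
      | zero => simp
      | add t s ht hs => simp only [map_add, LinearMap.add_apply, ht, hs]
      | tmul a b =>
        rw [LinearMap.rTensor_tmul, LinearMap.mul'_apply, finiteDualIncl_mul,
          finiteDualIncl_antipode]
        simp only [LinearMap.coe_comp, Function.comp_apply]
        generalize (Coalgebra.comul x : H ⊗[k] H) = r
        induction r with
        | zero => simp
        | add t s ht hs => simp only [map_add, ht, hs]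
        | tmul p q => simp
    refine (h1 _).trans ?_
    rw [finiteDual_comul_eq, pair₂_finiteDualComul, LinearMap.comp_apply,
      HopfAlgebra.mul_antipode_rTensor_comul_apply]
    change _ = finiteDualIncl k H (algebraMap k _ (finiteDualIncl k H l 1)) x
    rw [Algebra.algebraMap_eq_smul_one, Algebra.algebraMap_eq_smul_one, map_smul, map_smul,
      finiteDualIncl_one]
    simp [mul_comm]
  mul_antipode_lTensor_comul := by
    apply LinearMap.ext
    intro l
    apply finiteDualIncl_injective
    ext x
    have h1 : ∀ t : FiniteDual k H ⊗[k] FiniteDual k H, finiteDualIncl k H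
        (LinearMap.mul' k _ ((finiteDualAntipode k H).lTensor _ t)) x =
          pair₂ k H t ((HopfAlgebra.antipode k).lTensor H (Coalgebra.comul x)) := by
      intro t
      induction t with
      | zero => simp
      | add t s ht hs => simp only [map_add, LinearMap.add_apply, ht, hs]
      | tmul a b =>
        rw [LinearMap.lTensor_tmul, LinearMap.mul'_apply, finiteDualIncl_mul,
          finiteDualIncl_antipode]
        simp only [LinearMap.coe_comp, Function.comp_apply]
        generalize (Coalgebra.comul x : H ⊗[k] H) = r
        induction r with
        | zero => simp
        | add t s ht hs => simp only [map_add, ht, hs]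
        | tmul p q => simp
    refine (h1 _).trans ?_
    rw [finiteDual_comul_eq, pair₂_finiteDualComul, LinearMap.comp_apply,
      HopfAlgebra.mul_antipode_lTensor_comul_apply]
    change _ = finiteDualIncl k H (algebraMap k _ (finiteDualIncl k H l 1)) x
    rw [Algebra.algebraMap_eq_smul_one, Algebra.algebraMap_eq_smul_one, map_smul, map_smul,
      finiteDualIncl_one]
    simp [mul_comm]

/-- The map `ρ^∨ (ϰ ⊗ id)`, as an algebra homomorphism `H° → End_k(A)`. -/
def HopfCoaction.dualActionHom {A : Type*} [Ring A] [Algebra k A] (ρ : HopfCoaction k H A) :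
    FiniteDual k H →ₐ[k] Module.End k A :=
  AlgHom.ofLinearMap (checkMap ρ.coact ∘ₗ finiteDualIncl k H)
    (by
      ext a
      rw [LinearMap.comp_apply, finiteDualIncl_one, checkMap_apply, ρ.counit]
      simp)
    (by
      intro l m
      ext a
      have h1 : ∀ t : A ⊗[k] H, TensorProduct.rid k A ((finiteDualIncl k H (l * m)).lTensor A t) =
          TensorProduct.rid k A ((LinearMap.mul' k k ∘ₗ TensorProduct.map (finiteDualIncl k H l)
            (finiteDualIncl k H m)).lTensor A (Coalgebra.comul.lTensor A t)) := by
        intro t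
        rw [finiteDualIncl_mul, ← LinearMap.comp_assoc, LinearMap.lTensor_comp_apply]
      have h2 : ∀ t : A ⊗[k] H, TensorProduct.rid k A ((LinearMap.mul' k k ∘ₗ
          TensorProduct.map (finiteDualIncl k H l) (finiteDualIncl k H m)).lTensor A
            (TensorProduct.assoc k A H H (ρ.coact.rTensor H t))) =
          TensorProduct.rid k A ((finiteDualIncl k H l).lTensor A (ρ.coact
            (TensorProduct.rid k A ((finiteDualIncl k H m).lTensor A t)))) := by
        intro t
        induction t with
        | zero => simp
        | add t s ht hs => simp only [map_add, ht, hs]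
        | tmul b x =>
          simp only [LinearMap.rTensor_tmul, LinearMap.lTensor_tmul, TensorProduct.rid_tmul,
            map_smul]
          generalize ρ.coact b = r
          induction r with
          | zero => simp
          | add t s ht hs => simp only [TensorProduct.add_tmul, map_add, smul_add, ht, hs]
          | tmul c y => simp [smul_smul, mul_comm]
      simp only [LinearMap.comp_apply, Module.End.mul_apply, checkMap_apply]
      rw [h1, ρ.coassoc, h2])

/-- The action `ρ^∨ (ϰ ⊗ id) : H° ⊗ A → A` dual to a coaction `ρ : A → A ⊗ H`. -/
def HopfCoaction.dualAction {A : Type*} [Ring A] [Algebra k A] (ρ : HopfCoaction k H A) :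
    HopfAction k (FiniteDual k H) A where
  act := ρ.dualActionHom
  act_mul := by
    intro l a b
    have h1 : ∀ t : FiniteDual k H ⊗[k] FiniteDual k H,
        LinearMap.mul' k A (TensorProduct.homTensorHomMap (RingHom.id k) A A A A
          (TensorProduct.map (checkMap ρ.coact ∘ₗ finiteDualIncl k H)
            (checkMap ρ.coact ∘ₗ finiteDualIncl k H) t) (a ⊗ₜ[k] b)) =
        TensorProduct.rid k A (TensorProduct.map (LinearMap.mul' k A) (pair₂ k H t)
          (TensorProduct.tensorTensorTensorComm k A H A H (ρ.coact a ⊗ₜ ρ.coact b))) := by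
      intro t
      induction t with
      | zero => simp
      | add t s ht hs =>
        simp only [map_add, LinearMap.add_apply, TensorProduct.map_add_right, ht, hs]
      | tmul l m =>
        simp only [TensorProduct.map_tmul, TensorProduct.homTensorHomMap_apply,
          LinearMap.mul'_apply, LinearMap.comp_apply, checkMap_apply]
        generalize ρ.coact a = r
        generalize ρ.coact b = r'
        induction r with
        | zero => simp
        | add t t' ht ht' => simp only [TensorProduct.add_tmul, map_add, add_mul, ht, ht']
        | tmul p q =>
          induction r' with
          | zero => simp
          | add t t' ht ht' => simp only [TensorProduct.tmul_add, map_add, mul_add, ht, ht']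
          | tmul p' q' => simp [smul_smul, mul_comm]
    have h2 : ∀ r r' : A ⊗[k] H,
        TensorProduct.rid k A ((finiteDualIncl k H l).lTensor A (r * r')) =
        TensorProduct.rid k A (TensorProduct.map (LinearMap.mul' k A)
          (finiteDualIncl k H l ∘ₗ LinearMap.mul' k H)
          (TensorProduct.tensorTensorTensorComm k A H A H (r ⊗ₜ r'))) := by
      intro r r'
      induction r with
      | zero => simp
      | add t t' ht ht' => simp only [TensorProduct.add_tmul, map_add, add_mul, ht, ht']
      | tmul p q =>
        induction r' with
        | zero => simp
        | add t t' ht ht' => simp only [TensorProduct.tmul_add, map_add, mul_add, ht, ht']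
        | tmul p' q' => simp
    refine Eq.trans ?_ (h1 _).symm
    rw [finiteDual_comul_eq, pair₂_finiteDualComul, ← h2, ← ρ.map_mul]
    rfl

end FiniteDual

/-! ### Hopf algebras given by generators and relations -/

section Presented

variable {k : Type u} [Field k]

/-- A bialgebra with an algebra anti-endomorphism satisfying the antipode axioms on a set of
algebra generators is a Hopf algebra. -/
@[reducible]
def hopfOfGenerators {B : Type v} [Ring B] [Bialgebra k B] (S : B →ₐ[k] Bᵐᵒᵖ) (s : Set B)
    (hs : Algebra.adjoin k s = ⊤)
    (hl : ∀ x ∈ s, LinearMap.mul' k B (((MulOpposite.opLinearEquiv k).symm.toLinearMap ∘ₗ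
      S.toLinearMap).rTensor B (Coalgebra.comul x)) = algebraMap k B (Coalgebra.counit x))
    (hr : ∀ x ∈ s, LinearMap.mul' k B (((MulOpposite.opLinearEquiv k).symm.toLinearMap ∘ₗ
      S.toLinearMap).lTensor B (Coalgebra.comul x)) = algebraMap k B (Coalgebra.counit x)) :
    HopfAlgebra k B where
  antipode := (MulOpposite.opLinearEquiv k).symm.toLinearMap ∘ₗ S.toLinearMap
  mul_antipode_rTensor_comul := by
    ext x
    have hx : x ∈ Algebra.adjoin k s := hs ▸ Algebra.mem_top
    simp only [LinearMap.comp_apply]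
    induction hx using Algebra.adjoin_induction with
    | mem x hx => exact hl x hx
    | algebraMap r => simp [Algebra.TensorProduct.algebraMap_apply]
    | add x y _ _ hx hy => simp only [map_add, hx, hy]
    | mul x y _ _ hx hy =>
      rw [Bialgebra.comul_mul, Bialgebra.counit_mul]
      have key : ∀ u w : B ⊗[k] B, ∀ r : k, LinearMap.mul' k B
          (((MulOpposite.opLinearEquiv k).symm.toLinearMap ∘ₗ S.toLinearMap).rTensor B u) =
            algebraMap k B r → LinearMap.mul' k B (((MulOpposite.opLinearEquiv k).symm.toLinearMap
              ∘ₗ S.toLinearMap).rTensor B (u * w)) = r • LinearMap.mul' k B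
            (((MulOpposite.opLinearEquiv k).symm.toLinearMap ∘ₗ S.toLinearMap).rTensor B w) := by
        intro u w r hu
        induction w with
        | zero => simp
        | add w w' h h' => simp only [mul_add, map_add, h, h', smul_add]
        | tmul p q =>
          have h3 : ∀ u : B ⊗[k] B, LinearMap.mul' k B
              (((MulOpposite.opLinearEquiv k).symm.toLinearMap ∘ₗ S.toLinearMap).rTensor B
                (u * p ⊗ₜ q)) = (S p).unop * LinearMap.mul' k B
              (((MulOpposite.opLinearEquiv k).symm.toLinearMap ∘ₗ S.toLinearMap).rTensor B u) * q
              := by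
            intro u
            induction u with
            | zero => simp
            | add w w' h h' => simp only [add_mul, mul_add, map_add, h, h']
            | tmul p' q' => simp [mul_assoc]
          rw [h3, hu, ← Algebra.commutes, mul_assoc, ← Algebra.smul_def]
          simp
      rw [key _ _ _ hx, hy]
      simp [Algebra.smul_def]
  mul_antipode_lTensor_comul := by
    ext x
    have hx : x ∈ Algebra.adjoin k s := hs ▸ Algebra.mem_top
    simp only [LinearMap.comp_apply]
    induction hx using Algebra.adjoin_induction with
    | mem x hx => exact hr x hx
    | algebraMap r => simp [Algebra.TensorProduct.algebraMap_apply]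
    | add x y _ _ hx hy => simp only [map_add, hx, hy]
    | mul x y _ _ hx hy =>
      rw [Bialgebra.comul_mul, Bialgebra.counit_mul]
      have key : ∀ u w : B ⊗[k] B, ∀ r : k, LinearMap.mul' k B
          (((MulOpposite.opLinearEquiv k).symm.toLinearMap ∘ₗ S.toLinearMap).lTensor B w) =
            algebraMap k B r → LinearMap.mul' k B (((MulOpposite.opLinearEquiv k).symm.toLinearMap
              ∘ₗ S.toLinearMap).lTensor B (u * w)) = r • LinearMap.mul' k B
            (((MulOpposite.opLinearEquiv k).symm.toLinearMap ∘ₗ S.toLinearMap).lTensor B u) := by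
        intro u w r hw
        induction u with
        | zero => simp
        | add w w' h h' => simp only [add_mul, map_add, h, h', smul_add]
        | tmul p q =>
          have h3 : ∀ w : B ⊗[k] B, LinearMap.mul' k B
              (((MulOpposite.opLinearEquiv k).symm.toLinearMap ∘ₗ S.toLinearMap).lTensor B
                (p ⊗ₜ q * w)) = p * LinearMap.mul' k B
              (((MulOpposite.opLinearEquiv k).symm.toLinearMap ∘ₗ S.toLinearMap).lTensor B w) *
                (S q).unop := by
            intro u
            induction u with
            | zero => simp
            | add w w' h h' => simp only [add_mul, mul_add, map_add, h, h']
            | tmul p' q' => simp [mul_assoc]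
          rw [h3, hw, ← Algebra.commutes, mul_assoc, ← Algebra.smul_def]
          simp
      rw [key _ _ _ hy, hx]
      rw [Algebra.smul_def, Algebra.linearMap_apply, Algebra.linearMap_apply, ← RingHom.map_mul,
        mul_comm]

lemma adjoin_ringQuot_eq_top {X : Type v} (r : FreeAlgebra k X → FreeAlgebra k X → Prop) :
    Algebra.adjoin k (Set.range fun x => RingQuot.mkAlgHom k r (FreeAlgebra.ι k x)) = ⊤ := by
  have := congrArg (Subalgebra.map (RingQuot.mkAlgHom k r)) (FreeAlgebra.adjoin_range_ι k X)
  rw [AlgHom.map_adjoin, ← Set.range_comp, Algebra.map_top,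
    (AlgHom.range_eq_top _).2 (RingQuot.mkAlgHom_surjective k r)] at this
  exact this

variable (k)

/-! #### The Manin universal coacting Hopf algebra of `k × k` -/

/-- The generators `c, d, h`. -/
inductive ManinGen : Type
  | c
  | d
  | h

/-- The relations `cd = 1`, `dc = 1`, `h² = h`, `hc + ch + c² = c`. -/
inductive ManinRel : FreeAlgebra k ManinGen → FreeAlgebra k ManinGen → Prop
  | cd : ManinRel (FreeAlgebra.ι k .c * FreeAlgebra.ι k .d) 1
  | dc : ManinRel (FreeAlgebra.ι k .d * FreeAlgebra.ι k .c) 1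
  | hh : ManinRel (FreeAlgebra.ι k .h ^ 2) (FreeAlgebra.ι k .h)
  | hc : ManinRel (FreeAlgebra.ι k .h * FreeAlgebra.ι k .c + FreeAlgebra.ι k .c *
      FreeAlgebra.ι k .h + FreeAlgebra.ι k .c ^ 2) (FreeAlgebra.ι k .c)

/-- The algebra `k⟨c, d, h⟩ / (cd - 1, dc - 1, h² - h, hc + ch + c² - c)`. -/
def Manin : Type u := RingQuot (ManinRel k)

namespace Manin

instance : Ring (Manin k) := inferInstanceAs (Ring (RingQuot (ManinRel k)))

instance : Algebra k (Manin k) := inferInstanceAs (Algebra k (RingQuot (ManinRel k)))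

/-- The images of the generators. -/
def gen (x : ManinGen) : Manin k := RingQuot.mkAlgHom k (ManinRel k) (FreeAlgebra.ι k x)

/-- The image of `c`. -/
abbrev c : Manin k := gen k .c

/-- The image of `d`. -/
abbrev d : Manin k := gen k .d

/-- The image of `h`. -/
abbrev h : Manin k := gen k .h

lemma c_mul_d : c k * d k = 1 := by
  have := RingQuot.mkAlgHom_rel k (ManinRel.cd (k := k))
  rwa [map_mul, map_one] at this

lemma d_mul_c : d k * c k = 1 := by
  have := RingQuot.mkAlgHom_rel k (ManinRel.dc (k := k))
  rwa [map_mul, map_one] at this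

lemma h_mul_h : h k * h k = h k := by
  have := RingQuot.mkAlgHom_rel k (ManinRel.hh (k := k))
  rwa [map_pow, sq] at this

lemma h_c_rel : h k * c k + c k * h k + c k * c k = c k := by
  have := RingQuot.mkAlgHom_rel k (ManinRel.hc (k := k))
  rwa [map_add, map_add, map_mul, map_mul, map_pow, sq] at this

variable {k}

/-- Algebra homomorphisms out of `Manin k`. -/
def lift {B : Type*} [Ring B] [Algebra k B] (f : ManinGen → B) (h1 : f .c * f .d = 1)
    (h2 : f .d * f .c = 1) (h3 : f .h * f .h = f .h)
    (h4 : f .h * f .c + f .c * f .h + f .c * f .c = f .c) : Manin k →ₐ[k] B :=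
  RingQuot.liftAlgHom k ⟨FreeAlgebra.lift k f, by
    intro x y hxy
    cases hxy <;> simp [h1, h2, h3, h4, sq]⟩

@[simp] lemma lift_gen {B : Type*} [Ring B] [Algebra k B] (f : ManinGen → B) (h1 h2 h3 h4)
    (x : ManinGen) : lift (k := k) f h1 h2 h3 h4 (gen k x) = f x := by
  have := RingQuot.liftAlgHom_mkAlgHom_apply k (FreeAlgebra.lift k f) (s := ManinRel k) (by
    intro x y hxy
    cases hxy <;> simp [h1, h2, h3, h4, sq]) (FreeAlgebra.ι k x)
  exact this.trans (FreeAlgebra.lift_ι_apply _ _)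

lemma hom_ext {B : Type*} [Ring B] [Algebra k B] {f g : Manin k →ₐ[k] B}
    (H : ∀ x, f (gen k x) = g (gen k x)) : f = g := by
  apply RingQuot.ringQuot_ext'
  apply FreeAlgebra.hom_ext
  funext x
  exact H x

variable (k)

/-- `Δ c = c ⊗ c`, `Δ d = d ⊗ d`, `Δ h = h ⊗ c + 1 ⊗ h`. -/
def comulHom : Manin k →ₐ[k] Manin k ⊗[k] Manin k :=
  lift (fun
    | .c => c k ⊗ₜ c k
    | .d => d k ⊗ₜ d k
    | .h => h k ⊗ₜ c k + 1 ⊗ₜ h k)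
    (by simp [c_mul_d, Algebra.TensorProduct.one_def])
    (by simp [d_mul_c, Algebra.TensorProduct.one_def])
    (by
      change (h k ⊗ₜ[k] c k + 1 ⊗ₜ[k] h k) * (h k ⊗ₜ[k] c k + 1 ⊗ₜ[k] h k) =
        h k ⊗ₜ[k] c k + 1 ⊗ₜ[k] h k
      simp only [mul_add, add_mul, Algebra.TensorProduct.tmul_mul_tmul, h_mul_h, mul_one, one_mul]
      have e : h k ⊗ₜ[k] c k = h k ⊗ₜ[k] (h k * c k + c k * h k + c k * c k) := by rw [h_c_rel]
      conv_rhs => rw [e]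
      simp only [TensorProduct.tmul_add]
      abel)
    (by
      change (h k ⊗ₜ[k] c k + 1 ⊗ₜ[k] h k) * c k ⊗ₜ[k] c k +
        c k ⊗ₜ[k] c k * (h k ⊗ₜ[k] c k + 1 ⊗ₜ[k] h k) + c k ⊗ₜ[k] c k * c k ⊗ₜ[k] c k =
        c k ⊗ₜ[k] c k
      simp only [mul_add, add_mul, Algebra.TensorProduct.tmul_mul_tmul, mul_one, one_mul]
      have e : c k ⊗ₜ[k] c k = (h k * c k + c k * h k + c k * c k) ⊗ₜ[k] (c k * c k) +
          c k ⊗ₜ[k] (h k * c k + c k * h k) := by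
        rw [h_c_rel, ← TensorProduct.tmul_add]
        congr 1
        conv_lhs => rw [← h_c_rel]
        abel
      conv_rhs => rw [e]
      simp only [TensorProduct.tmul_add, TensorProduct.add_tmul]
      abel)

/-- `ε(c) = ε(d) = 1`, `ε(h) = 0`. -/
def counitHom : Manin k →ₐ[k] k :=
  lift (fun
    | .c => 1
    | .d => 1
    | .h => 0) (by simp) (by simp) (by simp) (by simp)

instance : Bialgebra k (Manin k) :=
  Bialgebra.ofAlgHom (comulHom k) (counitHom k)
    (by
      apply hom_ext
      rintro (_ | _ | _)
      · simp [comulHom]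
      · simp [comulHom]
      · simp [comulHom, TensorProduct.add_tmul, TensorProduct.tmul_add,
          Algebra.TensorProduct.one_def, add_assoc])
    (by
      apply hom_ext
      rintro (_ | _ | _)
      · simp [comulHom, counitHom]
      · simp [comulHom, counitHom]
      · simp [comulHom, counitHom])
    (by
      apply hom_ext
      rintro (_ | _ | _)
      · simp [comulHom, counitHom]
      · simp [comulHom, counitHom]
      · simp [comulHom, counitHom])

lemma comul_c : Coalgebra.comul (R := k) (c k) = c k ⊗ₜ[k] c k :=
  lift_gen _ _ _ _ _ _

lemma comul_d : Coalgebra.comul (R := k) (d k) = d k ⊗ₜ[k] d k :=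
  lift_gen _ _ _ _ _ _

lemma comul_h : Coalgebra.comul (R := k) (h k) = h k ⊗ₜ[k] c k + 1 ⊗ₜ[k] h k :=
  lift_gen _ _ _ _ _ _

lemma counit_c : Coalgebra.counit (R := k) (c k) = 1 := lift_gen _ _ _ _ _ _

lemma counit_d : Coalgebra.counit (R := k) (d k) = 1 := lift_gen _ _ _ _ _ _

lemma counit_h : Coalgebra.counit (R := k) (h k) = 0 := lift_gen _ _ _ _ _ _

/-- The relation `dh + hd - d + 1 = 0`. -/
lemma d_h_rel : d k * h k + h k * d k + 1 = d k := by
  have := congrArg (fun z => d k * z * d k) (h_c_rel k)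
  simp only [mul_add, add_mul] at this
  have e1 : d k * (h k * c k) * d k = d k * h k := by
    rw [mul_assoc, mul_assoc, c_mul_d, mul_one]
  have e2 : d k * (c k * h k) * d k = h k * d k := by
    rw [← mul_assoc, d_mul_c, one_mul]
  have e3 : d k * (c k * c k) * d k = 1 := by
    rw [← mul_assoc, d_mul_c, one_mul, c_mul_d]
  have e4 : d k * c k * d k = d k := by rw [d_mul_c, one_mul]
  rwa [e1, e2, e3, e4] at this

/-- The anti-homomorphism with `S c = d`, `S d = c`, `S h = - h d`. -/
def antipodeHom : Manin k →ₐ[k] (Manin k)ᵐᵒᵖ :=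
  lift (fun
    | .c => MulOpposite.op (d k)
    | .d => MulOpposite.op (c k)
    | .h => MulOpposite.op (- (h k * d k)))
    (by rw [← MulOpposite.op_mul, c_mul_d, MulOpposite.op_one])
    (by rw [← MulOpposite.op_mul, d_mul_c, MulOpposite.op_one])
    (by
      rw [← MulOpposite.op_mul]
      congr 1
      have e : d k * h k = d k - h k * d k - 1 := by
        rw [eq_sub_iff_add_eq, eq_sub_iff_add_eq, add_right_comm]
        exact d_h_rel k
      have : - (h k * d k) * - (h k * d k) = h k * (d k * h k) * d k := by noncomm_ring
      rw [this, e]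
      have : h k * (d k - h k * d k - 1) * d k =
        h k * d k * d k - (h k * h k) * d k * d k - h k * d k := by noncomm_ring
      rw [this, h_mul_h]
      abel)
    (by
      simp only [← MulOpposite.op_mul, ← MulOpposite.op_add]
      congr 1
      have e : d k * h k = d k - h k * d k - 1 := by
        rw [eq_sub_iff_add_eq, eq_sub_iff_add_eq, add_right_comm]
        exact d_h_rel k
      have : d k * - (h k * d k) + - (h k * d k) * d k + d k * d k =
        - (d k * h k) * d k - h k * d k * d k + d k * d k := by noncomm_ring
      rw [this, e]
      noncomm_ring)

instance : HopfAlgebra k (Manin k) :=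
  hopfOfGenerators (antipodeHom k) _ (adjoin_ringQuot_eq_top (ManinRel k))
    (by
      rintro _ ⟨(_ | _ | _), rfl⟩
      · change LinearMap.mul' k _ (LinearMap.rTensor _ _ (Coalgebra.comul (c k))) =
          algebraMap k _ (Coalgebra.counit (c k))
        simp [comul_c, counit_c, antipodeHom, d_mul_c]
      · change LinearMap.mul' k _ (LinearMap.rTensor _ _ (Coalgebra.comul (d k))) =
          algebraMap k _ (Coalgebra.counit (d k))
        simp [comul_d, counit_d, antipodeHom, c_mul_d]
      · change LinearMap.mul' k _ (LinearMap.rTensor _ _ (Coalgebra.comul (h k))) =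
          algebraMap k _ (Coalgebra.counit (h k))
        simp [comul_h, counit_h, antipodeHom, mul_assoc, d_mul_c])
    (by
      rintro _ ⟨(_ | _ | _), rfl⟩
      · change LinearMap.mul' k _ (LinearMap.lTensor _ _ (Coalgebra.comul (c k))) =
          algebraMap k _ (Coalgebra.counit (c k))
        simp [comul_c, counit_c, antipodeHom, c_mul_d]
      · change LinearMap.mul' k _ (LinearMap.lTensor _ _ (Coalgebra.comul (d k))) =
          algebraMap k _ (Coalgebra.counit (d k))
        simp [comul_d, counit_d, antipodeHom, d_mul_c]
      · change LinearMap.mul' k _ (LinearMap.lTensor _ _ (Coalgebra.comul (h k))) =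
          algebraMap k _ (Coalgebra.counit (h k))
        simp [comul_h, counit_h, antipodeHom])

end Manin

/-! #### The Sweedler algebra `H₄` -/

/-- The generators `c, v`. -/
inductive SweedlerGen : Type
  | c
  | v

/-- The relations `c² = 1`, `v² = 0`, `vc = -cv`. -/
inductive SweedlerRel : FreeAlgebra k SweedlerGen → FreeAlgebra k SweedlerGen → Prop
  | cc : SweedlerRel (FreeAlgebra.ι k .c ^ 2) 1
  | vv : SweedlerRel (FreeAlgebra.ι k .v ^ 2) 0
  | vc : SweedlerRel (FreeAlgebra.ι k .v * FreeAlgebra.ι k .c)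
      (- (FreeAlgebra.ι k .c * FreeAlgebra.ι k .v))

/-- The Sweedler algebra `H₄`, generated by `c, v` with `c² = 1`, `v² = 0`, `vc = -cv`. -/
def Sweedler : Type u := RingQuot (SweedlerRel k)

namespace Sweedler

instance : Ring (Sweedler k) := inferInstanceAs (Ring (RingQuot (SweedlerRel k)))

instance : Algebra k (Sweedler k) := inferInstanceAs (Algebra k (RingQuot (SweedlerRel k)))

/-- The images of the generators. -/
def gen (x : SweedlerGen) : Sweedler k :=
  RingQuot.mkAlgHom k (SweedlerRel k) (FreeAlgebra.ι k x)

/-- The image of `c`. -/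
abbrev c : Sweedler k := gen k .c

/-- The image of `v`. -/
abbrev v : Sweedler k := gen k .v

lemma adjoin_gen : Algebra.adjoin k (Set.range (gen k)) = ⊤ :=
  adjoin_ringQuot_eq_top (SweedlerRel k)

lemma c_mul_c : c k * c k = 1 := by
  have := RingQuot.mkAlgHom_rel k (SweedlerRel.cc (k := k))
  rwa [map_pow, map_one, sq] at this

lemma v_mul_v : v k * v k = 0 := by
  have := RingQuot.mkAlgHom_rel k (SweedlerRel.vv (k := k))
  rwa [map_pow, map_zero, sq] at this

lemma v_mul_c : v k * c k = - (c k * v k) := by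
  have := RingQuot.mkAlgHom_rel k (SweedlerRel.vc (k := k))
  rwa [map_neg, map_mul, map_mul] at this

variable {k}

/-- Algebra homomorphisms out of `H₄`. -/
def lift {B : Type*} [Ring B] [Algebra k B] (f : SweedlerGen → B) (h1 : f .c * f .c = 1)
    (h2 : f .v * f .v = 0) (h3 : f .v * f .c = - (f .c * f .v)) : Sweedler k →ₐ[k] B :=
  RingQuot.liftAlgHom k ⟨FreeAlgebra.lift k f, by
    intro x y hxy
    cases hxy <;> simp [h1, h2, h3, sq]⟩

@[simp] lemma lift_gen {B : Type*} [Ring B] [Algebra k B] (f : SweedlerGen → B) (h1 h2 h3)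
    (x : SweedlerGen) : lift (k := k) f h1 h2 h3 (gen k x) = f x := by
  have := RingQuot.liftAlgHom_mkAlgHom_apply k (FreeAlgebra.lift k f) (s := SweedlerRel k) (by
    intro x y hxy
    cases hxy <;> simp [h1, h2, h3, sq]) (FreeAlgebra.ι k x)
  exact this.trans (FreeAlgebra.lift_ι_apply _ _)

lemma hom_ext {B : Type*} [Ring B] [Algebra k B] {f g : Sweedler k →ₐ[k] B}
    (H : ∀ x, f (gen k x) = g (gen k x)) : f = g := by
  apply RingQuot.ringQuot_ext'
  apply FreeAlgebra.hom_ext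
  funext x
  exact H x

variable (k)

/-- `Δ c = c ⊗ c`, `Δ v = c ⊗ v + v ⊗ 1`. -/
def comulHom : Sweedler k →ₐ[k] Sweedler k ⊗[k] Sweedler k :=
  lift (fun
    | .c => c k ⊗ₜ c k
    | .v => c k ⊗ₜ v k + v k ⊗ₜ 1)
    (by simp [c_mul_c, Algebra.TensorProduct.one_def])
    (by simp [mul_add, add_mul, c_mul_c, v_mul_v, v_mul_c, TensorProduct.neg_tmul])
    (by simp [mul_add, add_mul, c_mul_c, v_mul_c, TensorProduct.neg_tmul, TensorProduct.tmul_neg,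
          add_comm])

/-- `ε(c) = 1`, `ε(v) = 0`. -/
def counitHom : Sweedler k →ₐ[k] k :=
  lift (fun
    | .c => 1
    | .v => 0) (by simp) (by simp) (by simp)

instance : Bialgebra k (Sweedler k) :=
  Bialgebra.ofAlgHom (comulHom k) (counitHom k)
    (by
      apply hom_ext
      rintro (_ | _)
      · simp [comulHom]
      · simp [comulHom, TensorProduct.add_tmul, TensorProduct.tmul_add,
          Algebra.TensorProduct.one_def, add_assoc])
    (by
      apply hom_ext
      rintro (_ | _)
      · simp [comulHom, counitHom]
      · simp [comulHom, counitHom])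
    (by
      apply hom_ext
      rintro (_ | _)
      · simp [comulHom, counitHom]
      · simp [comulHom, counitHom])

lemma comul_c : Coalgebra.comul (R := k) (c k) = c k ⊗ₜ[k] c k := lift_gen _ _ _ _ _

lemma comul_v : Coalgebra.comul (R := k) (v k) = c k ⊗ₜ[k] v k + v k ⊗ₜ[k] 1 :=
  lift_gen _ _ _ _ _

lemma counit_c : Coalgebra.counit (R := k) (c k) = 1 := lift_gen _ _ _ _ _

lemma counit_v : Coalgebra.counit (R := k) (v k) = 0 := lift_gen _ _ _ _ _

/-- The anti-homomorphism with `S c = c`, `S v = - c v`. -/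
def antipodeHom : Sweedler k →ₐ[k] (Sweedler k)ᵐᵒᵖ :=
  lift (fun
    | .c => MulOpposite.op (c k)
    | .v => MulOpposite.op (- (c k * v k)))
    (by rw [← MulOpposite.op_mul, c_mul_c, MulOpposite.op_one])
    (by
      rw [← MulOpposite.op_mul]
      have : - (c k * v k) * - (c k * v k) = c k * (v k * c k) * v k := by noncomm_ring
      rw [this, v_mul_c]
      have : c k * - (c k * v k) * v k = - (c k * c k * (v k * v k)) := by noncomm_ring
      rw [this, v_mul_v]
      simp)
    (by
      simp only [← MulOpposite.op_mul, ← MulOpposite.op_neg]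
      congr 1
      have : - (- (c k * v k) * c k) = c k * (v k * c k) := by noncomm_ring
      rw [this, v_mul_c])

instance : HopfAlgebra k (Sweedler k) :=
  hopfOfGenerators (antipodeHom k) _ (adjoin_ringQuot_eq_top (SweedlerRel k))
    (by
      rintro _ ⟨(_ | _), rfl⟩
      · change LinearMap.mul' k _ (LinearMap.rTensor _ _ (Coalgebra.comul (c k))) =
          algebraMap k _ (Coalgebra.counit (c k))
        simp [comul_c, counit_c, antipodeHom, c_mul_c]
      · change LinearMap.mul' k _ (LinearMap.rTensor _ _ (Coalgebra.comul (v k))) =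
          algebraMap k _ (Coalgebra.counit (v k))
        simp [comul_v, counit_v, antipodeHom])
    (by
      rintro _ ⟨(_ | _), rfl⟩
      · change LinearMap.mul' k _ (LinearMap.lTensor _ _ (Coalgebra.comul (c k))) =
          algebraMap k _ (Coalgebra.counit (c k))
        simp [comul_c, counit_c, antipodeHom, c_mul_c]
      · change LinearMap.mul' k _ (LinearMap.lTensor _ _ (Coalgebra.comul (v k))) =
          algebraMap k _ (Coalgebra.counit (v k))
        simp [comul_v, counit_v, antipodeHom, ← mul_assoc, c_mul_c])

end Sweedler

end Presented

/-! ### The actions on `k × k` -/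

section TwoPoints

variable (k : Type u) [Field k]

/-- The swap `(α, β) ↦ (β, α)` as a linear operator. -/
def swap : Module.End k (k × k) := (LinearEquiv.prodComm k k k).toLinearMap

@[simp] lemma swap_apply (a : k × k) : swap k a = (a.2, a.1) := rfl

/-- The operator `(α, β) ↦ (α - β, α - β)`. -/
def skew : Module.End k (k × k) :=
  (LinearMap.fst k k k - LinearMap.snd k k k).prod (LinearMap.fst k k k - LinearMap.snd k k k)

@[simp] lemma skew_apply (a : k × k) : skew k a = (a.1 - a.2, a.1 - a.2) := rfl

/-- The action `ψ₁` of the Hopf algebra `k`: `ψ₁(l ⊗ a) = l a`. -/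
def trivialAction : HopfAction k k (k × k) where
  act := Algebra.ofId k (Module.End k (k × k))
  act_mul := by
    intro r a b
    simp [Algebra.ofId_apply]

/-- The cyclic group of order two, written multiplicatively. -/
abbrev C2 : Type := Multiplicative (ZMod 2)

/-- The generator of `C2`. -/
def C2.c : C2 := Multiplicative.ofAdd 1

/-- The homomorphism from `C2` to linear operators with `c ↦ ((α, β) ↦ (β, α))`. -/
def swapHom : C2 →* Module.End k (k × k) where
  toFun g := if g = 1 then 1 else swap k
  map_one' := by simp
  map_mul' g g' := by
    have hs : swap k * swap k = 1 := by ext <;> simp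
    have : ∀ g : C2, g = 1 ∨ g = C2.c := by decide
    have h1 : C2.c ≠ 1 := by decide
    have h2 : C2.c * C2.c = 1 := by decide
    rcases this g with rfl | rfl <;> rcases this g' with rfl | rfl <;> simp [h1, h2, hs]

/-- The action `ψ₂` of the group Hopf algebra `k C₂`, with `c (α, β) = (β, α)`. -/
def swapAction : HopfAction k (MonoidAlgebra k C2) (k × k) where
  act := MonoidAlgebra.lift k (Module.End k (k × k)) C2 (swapHom k)
  act_mul := by
    intro x a b
    induction x using MonoidAlgebra.induction_linear with
    | zero => simp
    | add x y hx hy => simp only [map_add, LinearMap.add_apply, hx, hy]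
    | single g r =>
      by_cases hg : g = 1
      · subst hg; simp [swapHom]
      · simp [swapHom, hg]

lemma swapAction_c (a b : k) :
    (swapAction k).act (MonoidAlgebra.of k C2 C2.c) (a, b) = (b, a) := by
  have h1 : C2.c ≠ 1 := by decide
  simp [swapAction, swapHom, h1]

/-- The Manin coaction `ρ₃ : k × k → (k × k) ⊗ k⟨c, d, h⟩ / I`: the linear map with
`1 ↦ 1 ⊗ 1` and `e ↦ 1 ⊗ h + e ⊗ c`, where `e = (1, 0)`; here `(α, β) = β 1 + (α - β) e`. -/
def maninCoactionMap : (k × k) →ₗ[k] (k × k) ⊗[k] Manin k :=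
  (LinearMap.snd k k k).smulRight (1 ⊗ₜ[k] 1) +
    (LinearMap.fst k k k - LinearMap.snd k k k).smulRight
      (1 ⊗ₜ[k] Manin.h k + ((1, 0) : k × k) ⊗ₜ[k] Manin.c k)

lemma maninCoactionMap_apply (a : k × k) : maninCoactionMap k a = a.2 • (1 ⊗ₜ[k] 1) +
    (a.1 - a.2) • (1 ⊗ₜ[k] Manin.h k + ((1, 0) : k × k) ⊗ₜ[k] Manin.c k) := rfl

lemma maninCoactionMap_one : maninCoactionMap k 1 = 1 ⊗ₜ[k] 1 := by
  simp [maninCoactionMap_apply]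

lemma maninCoactionMap_e : maninCoactionMap k (1, 0) =
    1 ⊗ₜ[k] Manin.h k + ((1, 0) : k × k) ⊗ₜ[k] Manin.c k := by
  simp [maninCoactionMap_apply]

variable {k} in
/-- Two linear maps on `k × k` that agree on `1` and `e = (1, 0)` are equal. -/
lemma twoPoints_ext {M : Type*} [AddCommGroup M] [Module k M] {f g : (k × k) →ₗ[k] M}
    (h1 : f 1 = g 1) (he : f (1, 0) = g (1, 0)) : f = g := by
  ext
  · simpa using he
  · have : ((0, 1) : k × k) = 1 - (1, 0) := by ext <;> simp
    simp [this, h1, he]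

/-- The Manin coaction `ρ₃`. -/
def maninCoaction : HopfCoaction k (Manin k) (k × k) where
  coact := maninCoactionMap k
  map_mul := by
    have hee : ((1, 0) : k × k) * (1, 0) = (1, 0) := by ext <;> simp
    have hu : (1 ⊗ₜ[k] Manin.h k + ((1, 0) : k × k) ⊗ₜ[k] Manin.c k) *
        (1 ⊗ₜ[k] Manin.h k + ((1, 0) : k × k) ⊗ₜ[k] Manin.c k) =
        1 ⊗ₜ[k] Manin.h k + ((1, 0) : k × k) ⊗ₜ[k] Manin.c k := by
      have e : ((1, 0) : k × k) ⊗ₜ[k] Manin.c k = ((1, 0) : k × k) ⊗ₜ[k]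
          (Manin.h k * Manin.c k + Manin.c k * Manin.h k + Manin.c k * Manin.c k) := by
        rw [Manin.h_c_rel]
      conv_rhs => rw [e]
      simp only [mul_add, add_mul, Algebra.TensorProduct.tmul_mul_tmul, Manin.h_mul_h, one_mul,
        mul_one, hee, TensorProduct.tmul_add]
      abel
    intro a b
    rw [maninCoactionMap_apply, maninCoactionMap_apply, maninCoactionMap_apply,
      ← Algebra.TensorProduct.one_def]
    simp only [mul_add, add_mul, smul_mul_smul_comm, hu, one_mul, mul_one, Prod.fst_mul,
      Prod.snd_mul]
    module
  coassoc := by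
    have : (Coalgebra.comul (R := k) (A := Manin k)).lTensor (k × k) ∘ₗ maninCoactionMap k =
        (TensorProduct.assoc k (k × k) (Manin k) (Manin k)).toLinearMap ∘ₗ
          (maninCoactionMap k).rTensor (Manin k) ∘ₗ maninCoactionMap k := by
      apply twoPoints_ext
      · simp [maninCoactionMap_one, Algebra.TensorProduct.one_def]
      · simp [maninCoactionMap_one, maninCoactionMap_e, Manin.comul_h, Manin.comul_c,
          TensorProduct.tmul_add, TensorProduct.add_tmul]
        abel
    exact fun a => LinearMap.congr_fun this a
  counit := by
    have : (Coalgebra.counit (R := k) (A := Manin k)).lTensor (k × k) ∘ₗ maninCoactionMap k =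
        (TensorProduct.mk k (k × k) k).flip 1 := by
      apply twoPoints_ext
      · simp [maninCoactionMap_one]
      · simp [maninCoactionMap_e, Manin.counit_h, Manin.counit_c]
    exact fun a => LinearMap.congr_fun this a

/-- The action `ψ₃ = ρ₃^∨ (ϰ ⊗ id)` of the finite dual of `k⟨c, d, h⟩ / I`. -/
def maninDualAction : HopfAction k (FiniteDual k (Manin k)) (k × k) :=
  (maninCoaction k).dualAction

/-- The algebra homomorphism `H₄ → End(k × k)` with `c (α, β) = (β, α)`,
`v (α, β) = (α - β, α - β)`. -/
def sweedlerActionHom : Sweedler k →ₐ[k] Module.End k (k × k) :=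
  Sweedler.lift (fun
    | .c => swap k
    | .v => skew k)
    (by ext <;> simp)
    (by ext <;> simp)
    (by ext <;> simp)

/-- The action `ψ₃ₐ` of the Sweedler algebra `H₄`, with `c (α, β) = (β, α)` and
`v (α, β) = (α - β, α - β)`. -/
def sweedlerAction : HopfAction k (Sweedler k) (k × k) where
  act := sweedlerActionHom k
  act_mul := by
    have key : ∀ x : Sweedler k, (sweedlerActionHom k x) ∘ₗ LinearMap.mul' k (k × k) =
        LinearMap.mul' k (k × k) ∘ₗ (Module.endTensorEndAlgHom (R := k) (S := k) (A := k)
          (M := k × k) (N := k × k) (Algebra.TensorProduct.map (sweedlerActionHom k)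
            (sweedlerActionHom k) (Bialgebra.comulAlgHom k (Sweedler k) x))) := by
      intro x
      have hx : x ∈ Algebra.adjoin k (Set.range (Sweedler.gen k)) := by
        rw [Sweedler.adjoin_gen]
        exact Algebra.mem_top
      induction hx using Algebra.adjoin_induction with
      | mem x hx =>
        obtain ⟨(_ | _), rfl⟩ := hx
        · have : Bialgebra.comulAlgHom k (Sweedler k) (Sweedler.gen k .c) = _ :=
            Sweedler.comul_c k
          rw [this]
          apply TensorProduct.ext'
          intro a b
          simp [sweedlerActionHom, Module.endTensorEndAlgHom_apply]
        · have : Bialgebra.comulAlgHom k (Sweedler k) (Sweedler.gen k .v) = _ :=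
            Sweedler.comul_v k
          rw [this]
          apply TensorProduct.ext'
          intro a b
          simp only [sweedlerActionHom, LinearMap.comp_apply, Sweedler.lift_gen,
            LinearMap.mul'_apply, map_add, Algebra.TensorProduct.map_tmul,
            Module.endTensorEndAlgHom_apply, LinearMap.add_apply,
            TensorProduct.AlgebraTensorModule.map_tmul, map_one, Module.End.one_apply,
            skew_apply, swap_apply]
          ext <;> simp <;> ring
      | algebraMap r =>
        rw [AlgHom.commutes, AlgHom.commutes, AlgHom.commutes, AlgHom.commutes]
        apply TensorProduct.ext'
        intro a b
        simp
      | add x y _ _ hx hy =>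
        simp only [map_add, LinearMap.add_comp, LinearMap.comp_add, hx, hy]
      | mul x y _ _ hx hy =>
        simp only [map_mul, Module.End.mul_eq_comp]
        rw [LinearMap.comp_assoc, hy, ← LinearMap.comp_assoc, hx, LinearMap.comp_assoc]
    intro x a b
    exact LinearMap.congr_fun (key x) (a ⊗ₜ b)

lemma sweedlerAction_c (a b : k) : (sweedlerAction k).act (Sweedler.c k) (a, b) = (b, a) := by
  simp [sweedlerAction, sweedlerActionHom]

lemma sweedlerAction_v (a b : k) :
    (sweedlerAction k).act (Sweedler.v k) (a, b) = (a - b, a - b) := by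
  simp [sweedlerAction, sweedlerActionHom]

/-- The basis `1 = (1, 1)`, `e = (1, 0)` of `k × k`. -/
def basisOneE : Module.Basis (Fin 2) k (k × k) :=
  Module.Basis.ofEquivFun
    { toFun := fun a => ![a.2, a.1 - a.2]
      map_add' := by intro a b; ext i; fin_cases i <;> simp; ring
      map_smul' := by intro r a; ext i; fin_cases i <;> simp; ring
      invFun := fun x => (x 0 + x 1, x 0)
      left_inv := by intro a; ext <;> simp
      right_inv := by intro x; ext i; fin_cases i <;> simp }

lemma basisOneE_zero : basisOneE k 0 = (1, 1) := by
  ext <;> simp [basisOneE]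

lemma basisOneE_one : basisOneE k 1 = (1, 0) := by
  ext <;> simp [basisOneE]

variable {k} in
/-- The basis `(1, 1)`, `(1, -1)` of `k × k` in characteristic different from two. -/
def basisPlusMinus (h2 : ringChar k ≠ 2) : Module.Basis (Fin 2) k (k × k) :=
  have h : (2 : k) ≠ 0 := Ring.two_ne_zero h2
  Module.Basis.ofEquivFun
    { toFun := fun a => ![(a.1 + a.2) / 2, (a.1 - a.2) / 2]
      map_add' := by intro a b; ext i; fin_cases i <;> simp <;> ring
      map_smul' := by intro r a; ext i; fin_cases i <;> simp <;> ring
      invFun := fun x => (x 0 + x 1, x 0 - x 1)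
      left_inv := by intro a; ext <;> simp <;> field_simp <;> ring
      right_inv := by intro x; ext i; fin_cases i <;> simp <;> field_simp <;> ring }

variable {k} in
lemma basisPlusMinus_zero (h2 : ringChar k ≠ 2) : basisPlusMinus h2 0 = (1, 1) := by
  ext <;> simp [basisPlusMinus]

variable {k} in
lemma basisPlusMinus_one (h2 : ringChar k ≠ 2) : basisPlusMinus h2 1 = (1, -1) := by
  ext <;> simp [basisPlusMinus]

end TwoPoints

end HopfSym

end

/-! For a unital action write `h e = ξ(h) 1 + γ(h) e`, and regard `ξ = constCoeff ψ` and `γ =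
linCoeff ψ` as elements of the convolution algebra `H*`, whose unit is the counit `ε`. Since `e` is
idempotent, `ξ² = ξ` and `ξγ + γξ + γ² = γ`. Since `γ` describes the action of `H` on `(k × k) /
k1`, it is a character, hence convolution-invertible with inverse `γ ∘ S`. These are exactly the
defining relations of the Manin algebra, so `c ↦ γ`, `h ↦ ξ` defines an algebra homomorphism
`maninConvHom` to `H*`.

Universality of `ψ₃`: coalgebra homomorphisms `D → 𝓜°` are the transposes of algebra homomorphisms
`𝓜 → D*` (`dualCoalgHom`, `convHomOfCoalgHom`). The latter are determined by their values on `c` and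
`h`, which can be read off the operators on `k × k`; this is `maninDual_coalgHom_ext`. With `D = H`
it gives uniqueness; with `D = k` and `D = H ⊗ H` it shows that the transposed map preserves unit
and product.

Classification: the operator of `h` depends only on `(ε, ξ, γ)(h)`. If these triples fill `k³`, the
cosupport is the whole triangular algebra. Otherwise there is a linear relation between `ε`, `ξ` and
`γ`, and `ξγ + γξ + γ² = γ` turns it into `γ = ε - 2ξ`. Then every operator is a combination of `1`
and the swap, and the cosupport is that of `ψ₁` or of `ψ₂` according to whether `ξ` vanishes.

The universal properties are tested on actions not assumed unital. Each of the three cosupports has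
`1` as a common eigenvector, and `isUnital_of_eigenvector` deduces unitality: the eigenvalue is a
convolution-idempotent character, hence equal to `ε`. -/

noncomputable section

namespace HopfSym

open WithConv HopfAction

/-! ### Characters of a Hopf algebra in its convolution algebra -/

section Convolution

variable {k : Type*} [Field k]

/-- Composition with an algebra homomorphism respects convolution, so applying `χ` to the antipode
identity `id * S = ηε` gives the claim. This supplies the inverses used to cancel characters. -/
lemma AlgHom.toConv_mul_antipode {H : Type*} [Ring H] [HopfAlgebra k H] (χ : H →ₐ[k] k) :
    toConv χ.toLinearMap * toConv (χ.toLinearMap ∘ₗ HopfAlgebra.antipode k) =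
      (1 : WithConv (Module.Dual k H)) := by
  have := LinearMap.nonUnitalAlgHom_comp_convMul_distrib (χ : H →ₙₐ[k] k)
    (toConv LinearMap.id) (toConv (HopfAlgebra.antipode k (A := H)))
  rw [LinearMap.id_mul_antipode] at this
  apply ofConv_injective
  refine this.symm.trans ?_
  ext x
  exact (AlgHomClass.commutes χ _).trans (by simp)

lemma AlgHom.antipode_mul_toConv {H : Type*} [Ring H] [HopfAlgebra k H] (χ : H →ₐ[k] k) :
    toConv (χ.toLinearMap ∘ₗ HopfAlgebra.antipode k) * toConv χ.toLinearMap =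
      (1 : WithConv (Module.Dual k H)) := by
  have := LinearMap.nonUnitalAlgHom_comp_convMul_distrib (χ : H →ₙₐ[k] k)
    (toConv (HopfAlgebra.antipode k (A := H))) (toConv LinearMap.id)
  rw [LinearMap.antipode_mul_id] at this
  apply ofConv_injective
  refine this.symm.trans ?_
  ext x
  exact (AlgHomClass.commutes χ _).trans (by simp)

/-- Reduces comultiplicativity of a map given by finitely many functionals to identities between
their convolution products. -/
lemma map_smulRight_comul {D B C : Type*} [AddCommGroup D] [Module k D] [Coalgebra k D]
    [AddCommGroup B] [Module k B] [AddCommGroup C] [Module k C]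
    (p q : Module.Dual k D) (b : B) (c : C) (x : D) :
    TensorProduct.map (p.smulRight b) (q.smulRight c) (Coalgebra.comul (R := k) x) =
      (toConv p * toConv q) x • b ⊗ₜ[k] c := by
  rw [LinearMap.convMul_apply]
  generalize (Coalgebra.comul x : D ⊗[k] D) = t
  induction t with
  | zero => simp
  | add t s ht hs => simp only [map_add, ht, hs, add_smul]
  | tmul y z => simp [← TensorProduct.smul_tmul', smul_smul, mul_comm]

end Convolution

/-! ### Matrix coefficients of an action, and automatic unitality -/

namespace HopfAction

variable {k : Type*} [Field k] {A : Type*} [Ring A] [Algebra k A]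
  {H : Type*} [Ring H] [HopfAlgebra k H] (ψ : HopfAction k H A)

/-- The functional `h ↦ π(h a)`. -/
def coeff (π : Module.Dual k A) (a : A) : Module.Dual k H :=
  π ∘ₗ ψ.act.toLinearMap.flip a

@[simp] lemma coeff_apply (π : Module.Dual k A) (a : A) (h : H) :
    ψ.coeff π a h = π (ψ.act h a) := rfl

/-- A character `π` carries `h(ab) = (h₁a)(h₂b)` to a product of scalars, which is the convolution
product by definition. Algebraic identities in `A` thereby become identities in `H*`. -/
lemma coeff_mul (π : A →ₐ[k] k) (a b : A) :
    toConv (ψ.coeff π.toLinearMap (a * b)) =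
      toConv (ψ.coeff π.toLinearMap a) * toConv (ψ.coeff π.toLinearMap b) := by
  ext h
  rw [LinearMap.convMul_apply]
  change π (ψ.act h (a * b)) = _
  rw [ψ.act_mul]
  generalize (Coalgebra.comul h : H ⊗[k] H) = t
  induction t with
  | zero => simp
  | add t s ht hs => simp only [map_add, LinearMap.add_apply, ht, hs]
  | tmul y z => simp

/-- An action for which `1` is a common eigenvector is unital, provided that the algebra has a
character. -/
lemma isUnital_of_eigenvector (π : A →ₐ[k] k) (h1 : ∀ h : H, ∃ r : k, ψ.act h 1 = r • (1 : A)) :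
    ψ.IsUnital := by
  have hπ : ∀ h, ψ.act h 1 = π (ψ.act h 1) • (1 : A) := by
    intro h
    obtain ⟨r, hr⟩ := h1 h
    rw [hr]
    simp
  -- The eigenvalue of `h` on `1` is multiplicative in `h` because the eigenvector is common to all
  -- operators.
  let χ : H →ₐ[k] k := AlgHom.ofLinearMap (ψ.coeff π.toLinearMap 1) (by simp) (by
    intro x y
    change π (ψ.act (x * y) 1) = π (ψ.act x 1) * π (ψ.act y 1)
    rw [map_mul, Module.End.mul_apply, hπ y, map_smul, map_smul]
    simp [mul_comm])
  -- From `1 · 1 = 1`, the character is idempotent; being invertible, it is the unit of the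
  -- convolution algebra.
  have hχ : toConv χ.toLinearMap * toConv χ.toLinearMap = toConv χ.toLinearMap := by
    have := ψ.coeff_mul π 1 1
    rw [mul_one] at this
    exact this.symm
  have h2 : toConv χ.toLinearMap = (1 : WithConv (Module.Dual k H)) := by
    rw [← AlgHom.toConv_mul_antipode χ]
    nth_rewrite 2 [← hχ]
    rw [mul_assoc, AlgHom.toConv_mul_antipode, mul_one]
  intro h
  rw [hπ h]
  congr 1
  exact LinearMap.congr_fun (congrArg ofConv h2) h

end HopfAction

/-! ### Coalgebra homomorphisms into the finite dual -/

section DualCoalgHom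

/-- `M ⧸ I` is a quotient of `M ⧸ ker e`, which is isomorphic to a subspace of `V`. -/
lemma finiteDimensional_quotient_of_ker_le {k M V : Type*} [Field k] [Ring M] [Algebra k M]
    [AddCommGroup V] [Module k V] [FiniteDimensional k V] (e : M →ₗ[k] V) (I : Ideal M)
    [I.IsTwoSided] (h : ∀ m, e m = 0 → m ∈ I) : FiniteDimensional k (M ⧸ I) := by
  have : FiniteDimensional k (M ⧸ LinearMap.ker e) :=
    Module.Finite.equiv e.quotKerEquivRange.symm
  refine Module.Finite.of_surjective ((LinearMap.ker e).liftQ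
    (Ideal.Quotient.mkₐ k I).toLinearMap fun m hm => Ideal.Quotient.eq_zero_iff_mem.2 (h m hm)) ?_
  intro y
  obtain ⟨m, rfl⟩ := Ideal.Quotient.mkₐ_surjective k I y
  exact ⟨Submodule.Quotient.mk m, rfl⟩

variable {k : Type u} [Field k] {M : Type v} [Ring M]
  {D : Type w} [AddCommGroup D] [Module k D] [Coalgebra k D]

/-- For an algebra homomorphism from `M` to the convolution algebra of a coalgebra `D`, the
functionals on `M` given by the elements of `D` lie in the finite dual. -/
lemma vanishesCofinitely_of_convHom [Algebra k M] (f : M →ₐ[k] WithConv (Module.Dual k D)) (x : D) :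
    VanishesCofinitely k M
      (LinearMap.applyₗ x ∘ₗ (WithConv.linearEquiv k (Module.Dual k D)).toLinearMap ∘ₗ f.toLinearMap) := by
  classical
  let R := Coalgebra.Repr.arbitrary k x
  let R' := fun y : D => Coalgebra.Repr.arbitrary k y
  -- Comultiplying twice gives a finite sum `∑ x₁ ⊗ x₂ ⊗ x₃`; this is the finite set of middle
  -- factors `x₂`.
  let s : Finset D :=
    R.index.biUnion fun i => (R' (R.left i)).index.image (R' (R.left i)).right
  let e : M →ₗ[k] (s → k) := LinearMap.pi fun y =>
    LinearMap.applyₗ y.1 ∘ₗ (WithConv.linearEquiv k (Module.Dual k D)).toLinearMap ∘ₗ f.toLinearMap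
  -- The largest two-sided ideal on which the functional vanishes. As `f(pmq)(x) = ∑ f(p)(x₁)
  -- f(m)(x₂) f(q)(x₃)`, it contains every `m` whose image kills all the `x₂`, which is a finite set
  -- of linear conditions.
  let I : Ideal M :=
    { carrier := {m | ∀ p q, f (p * m * q) x = 0}
      zero_mem' := by intro p q; simp
      add_mem' := by
        intro a b ha hb p q
        have ha := ha p q
        have hb := hb p q
        rw [mul_add, add_mul, map_add]
        change f (p * a * q) x + f (p * b * q) x = 0
        rw [ha, hb, add_zero]
      smul_mem' := by
        intro c a ha p q
        rw [smul_eq_mul, ← mul_assoc]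
        exact ha (p * c) q }
  have hI : I.IsTwoSided := ⟨by
    intro a b ha p q
    rw [← mul_assoc, mul_assoc]
    exact ha p (b * q)⟩
  have hker : ∀ m, e m = 0 → m ∈ I := by
    intro m hm p q
    have hm : ∀ y ∈ s, f m y = 0 := fun y hy => congrFun hm ⟨y, hy⟩
    rw [map_mul, R.convMul_apply]
    refine Finset.sum_eq_zero fun i hi => ?_
    rw [map_mul, (R' (R.left i)).convMul_apply, Finset.sum_eq_zero, zero_mul]
    intro j hj
    rw [hm, mul_zero]
    exact Finset.mem_biUnion.2 ⟨i, hi, Finset.mem_image_of_mem _ hj⟩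
  refine ⟨I, hI, ?_, fun m hm => ?_⟩
  · exact finiteDimensional_quotient_of_ker_le e I hker
  · have := hm 1 1
    rw [one_mul, mul_one] at this
    exact this

variable [HopfAlgebra k M]

/-- The coalgebra homomorphism `D → M°` that corresponds to an algebra homomorphism from `M` to
the convolution algebra `D*`. -/
def dualCoalgHom (f : M →ₐ[k] WithConv (Module.Dual k D)) : D →ₗc[k] FiniteDual k M where
  toFun x := ⟨toConv (LinearMap.applyₗ x ∘ₗ (WithConv.linearEquiv k (Module.Dual k D)).toLinearMap ∘ₗ
    f.toLinearMap), vanishesCofinitely_of_convHom f x⟩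
  map_add' x y := by
    apply finiteDualIncl_injective
    ext m
    exact map_add (f m).ofConv x y
  map_smul' r x := by
    apply finiteDualIncl_injective
    ext m
    exact map_smul (f m).ofConv r x
  counit_comp := by
    ext x
    change f 1 x = _
    rw [map_one]
    simp
  map_comp_comul := by
    ext x
    -- Elements of `M° ⊗ M°` are separated by their pairing with `M ⊗ M`. There the comultiplication
    -- of `M°` becomes the product of `M`, and the claim becomes multiplicativity of `f`.
    apply pair₂_injective
    ext m m'
    simp only [LinearMap.comp_apply, finiteDual_comul_eq, TensorProduct.AlgebraTensorModule.curry_apply,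
      LinearMap.restrictScalars_self, TensorProduct.curry_apply, pair₂_finiteDualComul_apply]
    change _ = f (m * m') x
    rw [map_mul, LinearMap.convMul_apply]
    generalize (Coalgebra.comul x : D ⊗[k] D) = t
    induction t with
    | zero => simp
    | add t s ht hs => simp only [map_add, LinearMap.add_apply, ht, hs]
    | tmul y z => rfl

lemma dualCoalgHom_apply (f : M →ₐ[k] WithConv (Module.Dual k D)) (x : D) (m : M) :
    finiteDualIncl k M (dualCoalgHom f x) m = f m x := rfl

/-- The algebra homomorphism from `M` to the convolution algebra `D*` that corresponds to a
coalgebra homomorphism `D → M°`. -/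
def convHomOfCoalgHom (F : D →ₗc[k] FiniteDual k M) : M →ₐ[k] WithConv (Module.Dual k D) :=
  AlgHom.ofLinearMap ((WithConv.linearEquiv k (Module.Dual k D)).symm.toLinearMap ∘ₗ
      (finiteDualIncl k M ∘ₗ F.toLinearMap).flip)
    (by
      ext x
      exact (CoalgHomClass.counit_comp_apply F x).trans (by simp))
    (by
      intro m m'
      ext x
      rw [LinearMap.convMul_apply]
      change finiteDualIncl k M (F x) (m * m') = _
      rw [← pair₂_finiteDualComul_apply, ← finiteDual_comul_eq, ← CoalgHomClass.map_comp_comul_apply]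
      generalize (Coalgebra.comul x : D ⊗[k] D) = t
      induction t with
      | zero => simp
      | add t s ht hs => simp only [map_add, LinearMap.add_apply, ht, hs]
      | tmul y z => rfl)

lemma convHomOfCoalgHom_apply (F : D →ₗc[k] FiniteDual k M) (m : M) (x : D) :
    convHomOfCoalgHom F m x = finiteDualIncl k M (F x) m := rfl

end DualCoalgHom

/-! ### Rigidity of maps into the dual of the Manin Hopf algebra -/

section ManinDual

variable {k : Type u} [Field k]

/-- The value on `d` is forced, since `d` is the two-sided inverse of `c`. -/
lemma Manin.hom_ext_of_c_h {B : Type*} [Ring B] [Algebra k B] {f g : Manin k →ₐ[k] B}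
    (hc : f (Manin.c k) = g (Manin.c k)) (hh : f (Manin.h k) = g (Manin.h k)) : f = g := by
  apply Manin.hom_ext
  rintro (_ | _ | _)
  · exact hc
  · refine left_inv_eq_right_inv (a := f (Manin.c k)) ?_ ?_
    · rw [← map_mul, Manin.d_mul_c, map_one]
    · rw [hc, ← map_mul, Manin.c_mul_d, map_one]
  · exact hh

/-- The operator of `l` depends only on the three numbers `l(1)`, `l(h)`, `l(c)`. -/
lemma maninDualAction_apply (l : FiniteDual k (Manin k)) (a : k × k) :
    (maninDualAction k).act l a = (a.2 * finiteDualIncl k _ l 1) • (1 : k × k) +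
      (a.1 - a.2) • (finiteDualIncl k _ l (Manin.h k) • (1 : k × k) +
        finiteDualIncl k _ l (Manin.c k) • ((1, 0) : k × k)) := by
  change TensorProduct.rid k _ ((finiteDualIncl k _ l).lTensor _ (maninCoactionMap k a)) = _
  rw [maninCoactionMap_apply]
  simp [mul_smul]

/-- Coalgebra homomorphisms to `𝓜°` are determined by the operators on `k × k` they induce. -/
lemma maninDual_coalgHom_ext {D : Type w} [AddCommGroup D] [Module k D] [Coalgebra k D]
    {F G : D →ₗc[k] FiniteDual k (Manin k)}
    (h : ∀ x, (maninDualAction k).act (F x) = (maninDualAction k).act (G x)) : F = G := by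
  -- The image of `e` is `l(h) 1 + l(c) e`: its second coordinate is `l(h)`, and then the first
  -- determines `l(c)`.
  have h2 : ∀ x, finiteDualIncl k _ (F x) (Manin.h k) = finiteDualIncl k _ (G x) (Manin.h k) ∧
      finiteDualIncl k _ (F x) (Manin.c k) = finiteDualIncl k _ (G x) (Manin.c k) := by
    intro x
    have := LinearMap.congr_fun (h x) (1, 0)
    rw [maninDualAction_apply, maninDualAction_apply] at this
    simp only [Prod.ext_iff] at this
    simp at this
    refine ⟨this.2, ?_⟩
    simpa [this.2] using this.1
  -- Transposing turns `F` and `G` into algebra homomorphisms out of the Manin algebra, so agreement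
  -- on `c` and `h` suffices.
  have key : convHomOfCoalgHom F = convHomOfCoalgHom G := by
    apply Manin.hom_ext_of_c_h
    · ext x; exact (h2 x).2
    · ext x; exact (h2 x).1
  ext x
  apply finiteDualIncl_injective
  ext m
  rw [← convHomOfCoalgHom_apply, key, convHomOfCoalgHom_apply]

end ManinDual

/-! ### The functionals of an action on two points satisfy the Manin relations -/

section TwoPointCoefficients

variable {k : Type u} [Field k] {H : Type v} [Ring H] [HopfAlgebra k H]
  (ψ : HopfAction k H (k × k))

/-- The functional `ξ` with `h e = ξ(h) 1 + γ(h) e`. -/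
def constCoeff : Module.Dual k H := ψ.coeff (LinearMap.snd k k k) (1, 0)

/-- The functional `γ` with `h e = ξ(h) 1 + γ(h) e`. -/
def linCoeff : Module.Dual k H :=
  ψ.coeff (LinearMap.fst k k k) (1, 0) - ψ.coeff (LinearMap.snd k k k) (1, 0)

lemma act_e (h : H) : ψ.act h (1, 0) =
    constCoeff ψ h • (1 : k × k) + linCoeff ψ h • ((1, 0) : k × k) := by
  ext <;> simp [constCoeff, linCoeff]

lemma conv_fst_mul (a b : k × k) : toConv (ψ.coeff (LinearMap.fst k k k) (a * b)) =
    toConv (ψ.coeff (LinearMap.fst k k k) a) * toConv (ψ.coeff (LinearMap.fst k k k) b) :=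
  ψ.coeff_mul (AlgHom.fst k k k) a b

lemma conv_snd_mul (a b : k × k) : toConv (ψ.coeff (LinearMap.snd k k k) (a * b)) =
    toConv (ψ.coeff (LinearMap.snd k k k) a) * toConv (ψ.coeff (LinearMap.snd k k k) b) :=
  ψ.coeff_mul (AlgHom.snd k k k) a b

lemma constCoeff_mul_self :
    toConv (constCoeff ψ) * toConv (constCoeff ψ) = toConv (constCoeff ψ) := by
  have := conv_snd_mul ψ (1, 0) (1, 0)
  rw [Prod.mk_mul_mk, one_mul, zero_mul] at this
  exact this.symm

/-- The two coordinates of `h e` give the functionals `ξ + γ` and `ξ`. Both are convolution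
idempotents because `e` is, and the relation is the difference `(ξ + γ)² - ξ² = γ`. -/
lemma constCoeff_linCoeff_rel :
    toConv (constCoeff ψ) * toConv (linCoeff ψ) + toConv (linCoeff ψ) * toConv (constCoeff ψ) +
      toConv (linCoeff ψ) * toConv (linCoeff ψ) = toConv (linCoeff ψ) := by
  have h1 := conv_fst_mul ψ (1, 0) (1, 0)
  have h2 := conv_snd_mul ψ (1, 0) (1, 0)
  rw [Prod.mk_mul_mk, one_mul, zero_mul] at h1 h2
  unfold constCoeff linCoeff
  rw [toConv_sub]
  conv_rhs => rw [h1, h2]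
  simp only [sub_mul, mul_sub]
  abel

variable {ψ} (hψ : ψ.IsUnital)
include hψ

lemma act_eq_of_isUnital (h : H) (a : k × k) : ψ.act h a =
    (a.2 * Coalgebra.counit (R := k) h) • (1 : k × k) +
      (a.1 - a.2) • (constCoeff ψ h • (1 : k × k) + linCoeff ψ h • ((1, 0) : k × k)) := by
  have : a = a.2 • (1 : k × k) + (a.1 - a.2) • ((1, 0) : k × k) := by ext <;> simp
  conv_lhs => rw [this]
  rw [map_add, map_smul, map_smul, hψ h, act_e, smul_smul]

/-- Unitality makes `k1` a submodule, and `γ` is the scalar by which `H` acts on the one-dimensional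
quotient. -/
lemma linCoeff_mul (x y : H) : linCoeff ψ (x * y) = linCoeff ψ x * linCoeff ψ y := by
  have h1 : ψ.act (x * y) (1, 0) = ψ.act x (ψ.act y (1, 0)) := by rw [map_mul]; rfl
  rw [act_e ψ y, map_add, map_smul, map_smul, hψ x, act_e ψ x, act_e] at h1
  simp only [Prod.ext_iff] at h1
  simp at h1
  -- The coefficient of `e` is the difference of the two coordinates.
  linear_combination h1.1 - h1.2

/-- The functional `γ` as a character. -/
def linCharacter : H →ₐ[k] k :=
  AlgHom.ofLinearMap (linCoeff ψ) (by simp [linCoeff]) (linCoeff_mul hψ)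

/-- The algebra homomorphism from the Manin Hopf algebra to `H*` that corresponds to a unital
`H`-action on `k × k`. -/
def maninConvHom : Manin k →ₐ[k] WithConv (Module.Dual k H) :=
  Manin.lift (fun
    | .c => toConv (linCoeff ψ)
    | .d => toConv (linCoeff ψ ∘ₗ HopfAlgebra.antipode k)
    | .h => toConv (constCoeff ψ))
    (AlgHom.toConv_mul_antipode (linCharacter hψ)) (AlgHom.antipode_mul_toConv (linCharacter hψ))
    (constCoeff_mul_self ψ) (constCoeff_linCoeff_rel ψ)

lemma maninConvHom_c : maninConvHom hψ (Manin.c k) = toConv (linCoeff ψ) :=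
  Manin.lift_gen _ _ _ _ _ _

lemma maninConvHom_h : maninConvHom hψ (Manin.h k) = toConv (constCoeff ψ) :=
  Manin.lift_gen _ _ _ _ _ _

lemma maninDualAction_dualCoalgHom (h : H) :
    (maninDualAction k).act (dualCoalgHom (maninConvHom hψ) h) = ψ.act h := by
  refine LinearMap.ext fun a => ?_
  rw [maninDualAction_apply, act_eq_of_isUnital hψ, dualCoalgHom_apply, dualCoalgHom_apply,
    dualCoalgHom_apply, map_one, maninConvHom_c, maninConvHom_h]
  rfl

end TwoPointCoefficients

/-! ### Universality of the action dual to the Manin coaction -/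

section Universality

variable {k : Type u} [Field k] {H : Type v} [Ring H] [HopfAlgebra k H]
  {ψ : HopfAction k H (k × k)}

/-- A coalgebra homomorphism `H → 𝓜°` compatible with the actions on `k × k` is a bialgebra
homomorphism. -/
def bialgHomOfCoalgHom (F : H →ₗc[k] FiniteDual k (Manin k))
    (hF : ∀ x, (maninDualAction k).act (F x) = ψ.act x) : H →ₐc[k] FiniteDual k (Manin k) where
  toCoalgHom := F
  map_one' := by
    -- The two routes from `k` to `𝓜°` are coalgebra homomorphisms inducing the same operators, so
    -- they coincide.
    have := maninDual_coalgHom_ext (F := F.comp (Bialgebra.unitBialgHom k H : k →ₗc[k] H))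
      (G := (Bialgebra.unitBialgHom k (FiniteDual k (Manin k)) : k →ₗc[k] _)) (by
        intro r
        change (maninDualAction k).act (F (algebraMap k H r)) =
          (maninDualAction k).act (algebraMap k _ r)
        rw [hF, AlgHom.commutes, AlgHom.commutes])
    have h1 : F (algebraMap k H 1) = algebraMap k _ 1 := DFunLike.congr_fun this 1
    rwa [map_one (algebraMap k H), map_one (algebraMap k (FiniteDual k (Manin k)))] at h1
  map_mul' x y := by
    -- The product of a bialgebra is a coalgebra homomorphism, so the same rigidity applies to the
    -- two maps `H ⊗ H → 𝓜°`.
    have := maninDual_coalgHom_ext (F := F.comp (Bialgebra.mulCoalgHom k H))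
      (G := (Bialgebra.mulCoalgHom k (FiniteDual k (Manin k))).comp
        (Coalgebra.TensorProduct.map F F)) (by
        intro t
        change (maninDualAction k).act (F (LinearMap.mul' k H t)) = (maninDualAction k).act
          (LinearMap.mul' k _ (TensorProduct.map F.toLinearMap F.toLinearMap t))
        induction t with
        | zero => simp
        | add t s ht hs => simp only [map_add, ht, hs]
        | tmul x y =>
          rw [LinearMap.mul'_apply, hF, TensorProduct.map_tmul, LinearMap.mul'_apply, map_mul,
            map_mul]
          exact congrArg₂ _ (hF x).symm (hF y).symm)
    exact DFunLike.congr_fun this (x ⊗ₜ y)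

lemma existsUnique_bialgHom_maninDual (hψ : ψ.IsUnital) :
    ∃! φ : H →ₐc[k] FiniteDual k (Manin k),
      ∀ (h : H) (a : k × k), (maninDualAction k).act (φ h) a = ψ.act h a := by
  refine ⟨bialgHomOfCoalgHom (dualCoalgHom (maninConvHom hψ)) (maninDualAction_dualCoalgHom hψ),
    fun h a => LinearMap.congr_fun (maninDualAction_dualCoalgHom hψ h) a, fun φ hφ => ?_⟩
  have := maninDual_coalgHom_ext (F := (φ : H →ₗc[k] FiniteDual k (Manin k)))
    (G := dualCoalgHom (maninConvHom hψ)) (by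
      intro x
      rw [maninDualAction_dualCoalgHom hψ]
      exact LinearMap.ext (hφ x))
  exact DFunLike.ext _ _ fun x => DFunLike.congr_fun this x

end Universality

/-! ### Explicit cosupports inside the triangular operators -/

section Cosupports

variable (k : Type u) [Field k]

/-- The operator with upper triangular matrix `!![r, s; 0, t]` in the basis `1`, `e`. -/
def triangularOp : (k × k × k) →ₗ[k] Module.End k (k × k) where
  toFun t := (LinearMap.snd k k k).smulRight (t.1 • (1 : k × k)) +
    (LinearMap.fst k k k - LinearMap.snd k k k).smulRight
      (t.2.1 • (1 : k × k) + t.2.2 • ((1, 0) : k × k))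
  map_add' s t := by
    refine LinearMap.ext fun a => ?_
    ext <;> simp <;> ring
  map_smul' r t := by
    refine LinearMap.ext fun a => ?_
    ext <;> simp <;> ring

/-- The operator `α + β c`, where `c` is the swap. -/
def swapOp : (k × k) →ₗ[k] Module.End k (k × k) :=
  (LinearMap.fst k k k).smulRight 1 + (LinearMap.snd k k k).smulRight (swap k)

variable {k}

lemma triangularOp_apply (t : k × k × k) (a : k × k) : triangularOp k t a =
    a.2 • t.1 • (1 : k × k) + (a.1 - a.2) • (t.2.1 • (1 : k × k) + t.2.2 • ((1, 0) : k × k)) :=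
  rfl

lemma swapOp_apply (t : k × k) : swapOp k t = t.1 • 1 + t.2 • swap k := rfl

lemma swapOp_apply_apply (t a : k × k) :
    swapOp k t a = (t.1 * a.1 + t.2 * a.2, t.1 * a.2 + t.2 * a.1) := by
  rw [swapOp_apply]
  ext <;> simp

lemma triangularOp_injective : Function.Injective (triangularOp k) := by
  intro s t h
  have h1 := LinearMap.congr_fun h 1
  have he := LinearMap.congr_fun h (1, 0)
  rw [triangularOp_apply, triangularOp_apply] at h1 he
  simp only [Prod.ext_iff] at h1 he
  simp at h1 he
  obtain ⟨he1, he2⟩ := he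
  rw [he2] at he1
  exact Prod.ext h1 (Prod.ext he2 (add_left_cancel he1))

lemma swapOp_injective : Function.Injective (swapOp k) := by
  intro s t h
  have he := LinearMap.congr_fun h (1, 0)
  rw [swapOp_apply_apply, swapOp_apply_apply] at he
  simpa [Prod.ext_iff] using he

/-- The swap fixes `1` and sends `e` to `1 - e`. -/
lemma swapOp_eq_triangularOp (t : k × k) :
    swapOp k t = triangularOp k (t.1 + t.2, t.2, t.1 - t.2) := by
  refine LinearMap.ext fun a => ?_
  rw [swapOp_apply_apply, triangularOp_apply]
  ext <;> simp <;> ring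

lemma mem_range_triangularOp_iff {f : Module.End k (k × k)} :
    f ∈ LinearMap.range (triangularOp k) ↔ (f 1).1 = (f 1).2 := by
  constructor
  · rintro ⟨t, rfl⟩
    simp [triangularOp_apply]
  · intro h
    refine ⟨((f 1).2, (f (1, 0)).2, (f (1, 0)).1 - (f (1, 0)).2), ?_⟩
    apply twoPoints_ext
    · rw [triangularOp_apply]
      ext <;> simp [h]
    · rw [triangularOp_apply]
      ext <;> simp

lemma act_eq_triangularOp {H : Type v} [Ring H] [HopfAlgebra k H] {ψ : HopfAction k H (k × k)}
    (hψ : ψ.IsUnital) (h : H) :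
    ψ.act h = triangularOp k (Coalgebra.counit (R := k) h, constCoeff ψ h, linCoeff ψ h) := by
  refine LinearMap.ext fun a => ?_
  rw [act_eq_of_isUnital hψ, triangularOp_apply, smul_smul]

/-- Triangular operators have `1` as a common eigenvector. This allows universality to be tested
against actions that are not assumed unital. -/
lemma isUnital_of_cosupp_le_triangular {H : Type v} [Ring H] [HopfAlgebra k H]
    {ψ : HopfAction k H (k × k)}
    (h : ∀ f ∈ ψ.cosupp, f ∈ LinearMap.range (triangularOp k)) : ψ.IsUnital := by
  refine ψ.isUnital_of_eigenvector (AlgHom.snd k k k) fun x => ⟨(ψ.act x 1).2, ?_⟩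
  have := mem_range_triangularOp_iff.1 (h (ψ.act x) ⟨x, rfl⟩)
  ext <;> simp [this]

/-! The cosupports of the three actions. -/

lemma trivialAction_cosupp : (trivialAction k).cosupp = ⊥ := rfl

lemma trivialAction_isUnital : (trivialAction k).IsUnital := by
  intro r
  change algebraMap k (Module.End k (k × k)) r 1 = _
  simp [Module.algebraMap_end_apply]

lemma mem_trivialAction_cosupp {f : Module.End k (k × k)} :
    f ∈ (trivialAction k).cosupp ↔ ∃ r : k, f = r • 1 := by
  rw [trivialAction_cosupp, Algebra.mem_bot]
  simp only [Set.mem_range, Algebra.algebraMap_eq_smul_one, eq_comm]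

lemma swapAction_act_one_add (α β : k) : (swapAction k).act
    (α • MonoidAlgebra.of k C2 1 + β • MonoidAlgebra.of k C2 C2.c) = swapOp k (α, β) := by
  have h1 : C2.c ≠ 1 := by decide
  rw [map_add, map_smul, map_smul, swapOp_apply]
  simp only [swapAction, MonoidAlgebra.lift_of]
  simp [swapHom, h1]

lemma C2.eq_one_or_eq_c : ∀ g : C2, g = 1 ∨ g = C2.c := by decide

lemma monoidAlgebra_C2_eq (x : MonoidAlgebra k C2) : ∃ α β : k,
    x = α • MonoidAlgebra.of k C2 1 + β • MonoidAlgebra.of k C2 C2.c := by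
  induction x using MonoidAlgebra.induction_linear with
  | zero => exact ⟨0, 0, by simp⟩
  | add x y hx hy =>
    obtain ⟨α, β, rfl⟩ := hx
    obtain ⟨α', β', rfl⟩ := hy
    exact ⟨α + α', β + β', by module⟩
  | single g r =>
    rcases C2.eq_one_or_eq_c g with rfl | rfl
    · exact ⟨r, 0, by simp⟩
    · exact ⟨0, r, by simp⟩

lemma mem_swapAction_cosupp {f : Module.End k (k × k)} :
    f ∈ (swapAction k).cosupp ↔ f ∈ LinearMap.range (swapOp k) := by
  constructor
  · rintro ⟨x, rfl⟩
    obtain ⟨α, β, rfl⟩ := monoidAlgebra_C2_eq x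
    exact ⟨(α, β), (swapAction_act_one_add α β).symm⟩
  · rintro ⟨⟨α, β⟩, rfl⟩
    exact ⟨_, swapAction_act_one_add α β⟩

lemma range_swapOp_le : LinearMap.range (swapOp k) ≤ LinearMap.range (triangularOp k) := by
  rintro _ ⟨t, rfl⟩
  exact ⟨_, (swapOp_eq_triangularOp t).symm⟩

lemma swapAction_isUnital : (swapAction k).IsUnital :=
  isUnital_of_cosupp_le_triangular fun _ hf => range_swapOp_le (mem_swapAction_cosupp.1 hf)

lemma exists_finiteDual_of_rep {M : Type v} [Ring M] [HopfAlgebra k M] {B : Type*} [Ring B]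
    [Algebra k B] [FiniteDimensional k B] (f : M →ₐ[k] B) (g : B →ₗ[k] k) :
    ∃ l : FiniteDual k M, ∀ m, finiteDualIncl k M l m = g (f m) :=
  ⟨⟨toConv (g ∘ₗ f.toLinearMap), vanishesCofinitely_of_factor f g⟩, fun _ => rfl⟩

/-- A two-dimensional representation of the Manin Hopf algebra in which `1`, `c`, `h` are
linearly independent. -/
def Manin.matrixRep : Manin k →ₐ[k] Matrix (Fin 2) (Fin 2) k :=
  Manin.lift (fun
    | .c => !![-1, 1; 0, 1]
    | .d => !![-1, 1; 0, 1]
    | .h => !![1, 0; 0, 0])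
    (by ext i j; fin_cases i <;> fin_cases j <;> simp)
    (by ext i j; fin_cases i <;> fin_cases j <;> simp)
    (by ext i j; fin_cases i <;> fin_cases j <;> simp)
    (by ext i j; fin_cases i <;> fin_cases j <;> simp)

lemma Manin.matrixRep_c : Manin.matrixRep (Manin.c k) = !![-1, 1; 0, 1] :=
  Manin.lift_gen _ _ _ _ _ _

lemma Manin.matrixRep_h : Manin.matrixRep (Manin.h k) = !![1, 0; 0, 0] :=
  Manin.lift_gen _ _ _ _ _ _

lemma mem_maninDualAction_cosupp {f : Module.End k (k × k)} :
    f ∈ (maninDualAction k).cosupp ↔ f ∈ LinearMap.range (triangularOp k) := by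
  constructor
  · rintro ⟨l, rfl⟩
    rw [mem_range_triangularOp_iff]
    change ((maninDualAction k).act l 1).1 = ((maninDualAction k).act l 1).2
    rw [maninDualAction_apply]
    simp
  · rintro ⟨⟨r, s, t⟩, rfl⟩
    -- The functional on matrices with values `r`, `s`, `t` on the images of `1`, `h`, `c`. It
    -- exists in every characteristic because these three matrices are linearly independent; its
    -- pullback lies in the finite dual.
    let g : Matrix (Fin 2) (Fin 2) k →ₗ[k] k :=
      (r - s) • Matrix.entryLinearMap k k 1 1 + (t - r + 2 * s) • Matrix.entryLinearMap k k 0 1 +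
        s • Matrix.entryLinearMap k k 0 0
    obtain ⟨l, hl⟩ := exists_finiteDual_of_rep Manin.matrixRep g
    have h1 : finiteDualIncl k _ l 1 = r := by
      rw [hl, map_one]
      simp [g]
    have hh : finiteDualIncl k _ l (Manin.h k) = s := by
      rw [hl, Manin.matrixRep_h]
      simp [g]
    have hc : finiteDualIncl k _ l (Manin.c k) = t := by
      rw [hl, Manin.matrixRep_c]
      simp [g]
      ring
    refine ⟨l, LinearMap.ext fun a => ?_⟩
    change (maninDualAction k).act l a = _
    rw [maninDualAction_apply, triangularOp_apply, h1, hh, hc, smul_smul]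

lemma maninDualAction_isUnital : (maninDualAction k).IsUnital :=
  isUnital_of_cosupp_le_triangular fun _ hf => mem_maninDualAction_cosupp.1 hf

lemma finrank_swapAction_cosupp : Module.finrank k (swapAction k).cosupp = 2 := by
  have : Subalgebra.toSubmodule (swapAction k).cosupp = LinearMap.range (swapOp k) := by
    ext f
    exact mem_swapAction_cosupp
  rw [← Subalgebra.finrank_toSubmodule, this, LinearMap.finrank_range_of_inj swapOp_injective]
  simp

lemma finrank_maninDualAction_cosupp : Module.finrank k (maninDualAction k).cosupp = 3 := by
  have : Subalgebra.toSubmodule (maninDualAction k).cosupp =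
      LinearMap.range (triangularOp k) := by
    ext f
    exact mem_maninDualAction_cosupp
  rw [← Subalgebra.finrank_toSubmodule, this,
    LinearMap.finrank_range_of_inj triangularOp_injective]
  simp

/-! Descriptions of the cosupports by matrices. -/

/-- The only condition is on the entry below the diagonal, which is the `e`-coefficient of `f 1`. -/
lemma blockTriangular_toMatrix_basisOneE_iff {f : Module.End k (k × k)} :
    (LinearMap.toMatrix (basisOneE k) (basisOneE k) f).BlockTriangular id ↔
      f ∈ LinearMap.range (triangularOp k) := by
  rw [mem_range_triangularOp_iff]
  have h : LinearMap.toMatrix (basisOneE k) (basisOneE k) f 1 0 = (f 1).1 - (f 1).2 := by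
    rw [LinearMap.toMatrix_apply, basisOneE_zero]
    rfl
  rw [← sub_eq_zero, ← h]
  constructor
  · intro hf
    exact hf (by decide)
  · intro hf i j hij
    fin_cases i <;> fin_cases j <;> first | exact hf | exact absurd hij (by decide)

/-- The basis consists of eigenvectors of the swap with the distinct eigenvalues `1` and `-1`, so
the diagonal operators are those commuting with the swap, that is, the combinations of `1` and the
swap. -/
lemma isDiag_toMatrix_basisPlusMinus_iff (h2 : ringChar k ≠ 2) {f : Module.End k (k × k)} :
    (LinearMap.toMatrix (basisPlusMinus h2) (basisPlusMinus h2) f).IsDiag ↔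
      f ∈ LinearMap.range (swapOp k) := by
  have h : (2 : k) ≠ 0 := Ring.two_ne_zero h2
  have h01 : LinearMap.toMatrix (basisPlusMinus h2) (basisPlusMinus h2) f 0 1 =
      ((f (1, -1)).1 + (f (1, -1)).2) / 2 := by
    rw [LinearMap.toMatrix_apply, basisPlusMinus_one]
    rfl
  have h10 : LinearMap.toMatrix (basisPlusMinus h2) (basisPlusMinus h2) f 1 0 =
      ((f (1, 1)).1 - (f (1, 1)).2) / 2 := by
    rw [LinearMap.toMatrix_apply, basisPlusMinus_zero]
    rfl
  have e1 : ((1, 1) : k × k) = (1, 0) + (0, 1) := by simp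
  have e2 : ((1, -1) : k × k) = (1, 0) - (0, 1) := by simp
  constructor
  · intro hf
    have g1 : LinearMap.toMatrix (basisPlusMinus h2) (basisPlusMinus h2) f 0 1 = 0 := hf (show (0 : Fin 2) ≠ 1 by decide)
    have g2 : LinearMap.toMatrix (basisPlusMinus h2) (basisPlusMinus h2) f 1 0 = 0 := hf (show (1 : Fin 2) ≠ 0 by decide)
    rw [h01, div_eq_zero_iff, or_iff_left h, e2, map_sub] at g1
    rw [h10, div_eq_zero_iff, or_iff_left h, e1, map_add] at g2
    simp only [Prod.fst_sub, Prod.snd_sub, Prod.fst_add, Prod.snd_add] at g1 g2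
    -- The vanishing off-diagonal entries, added and subtracted, say that `f (0, 1)` is the swap of
    -- `f (1, 0)`, up to a factor `2` that is cancelled.
    have g3 : (f (0, 1)).1 = (f (1, 0)).2 := mul_left_cancel₀ h (by linear_combination g2 - g1)
    have g4 : (f (0, 1)).2 = (f (1, 0)).1 := mul_left_cancel₀ h (by linear_combination - g2 - g1)
    refine ⟨f (1, 0), ?_⟩
    apply LinearMap.prod_ext <;> apply LinearMap.ext_ring
    · change swapOp k (f (1, 0)) (1, 0) = f (1, 0)
      rw [swapOp_apply_apply]
      simp
    · change swapOp k (f (1, 0)) (0, 1) = f (0, 1)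
      rw [swapOp_apply_apply]
      ext <;> simp [g3, g4]
  · rintro ⟨t, rfl⟩ i j hij
    fin_cases i <;> fin_cases j
    · exact absurd rfl hij
    · refine h01.trans ?_
      rw [swapOp_apply_apply]
      simp
      ring_nf
      simp
    · refine h10.trans ?_
      rw [swapOp_apply_apply]
      simp
    · exact absurd rfl hij

lemma toMatrix_basisOneE_triangularOp (t : k × k × k) :
    LinearMap.toMatrix (basisOneE k) (basisOneE k) (triangularOp k t) =
      !![t.1, t.2.1; 0, t.2.2] := by
  have h : ∀ a : k × k, (basisOneE k).repr a 0 = a.2 ∧ (basisOneE k).repr a 1 = a.1 - a.2 :=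
    fun a => ⟨rfl, rfl⟩
  ext i j
  rw [LinearMap.toMatrix_apply]
  fin_cases i <;> fin_cases j <;>
    simp [h, basisOneE_zero, basisOneE_one, triangularOp_apply]

lemma mem_range_swapOp_iff_of_ringChar_eq_two (h2 : ringChar k = 2) {f : Module.End k (k × k)} :
    f ∈ LinearMap.range (swapOp k) ↔ ∃ α β : k,
      LinearMap.toMatrix (basisOneE k) (basisOneE k) f = !![α, β; 0, α] := by
  have : CharP k 2 := ringChar.of_eq h2
  constructor
  · rintro ⟨t, rfl⟩
    refine ⟨t.1 + t.2, t.2, ?_⟩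
    rw [swapOp_eq_triangularOp, toMatrix_basisOneE_triangularOp, CharTwo.sub_eq_add]
  · rintro ⟨α, β, hf⟩
    -- The diagonal entries of this operator are `(α - β) + β` and `(α - β) - β`; both equal `α` in
    -- characteristic two.
    refine ⟨(α - β, β), ?_⟩
    apply (LinearMap.toMatrix (basisOneE k) (basisOneE k)).injective
    rw [hf, swapOp_eq_triangularOp, toMatrix_basisOneE_triangularOp]
    simp [CharTwo.sub_eq_add, add_assoc, CharTwo.add_self_eq_zero]

/-! The Sweedler algebra. -/

lemma sweedlerAction_isUnital : (sweedlerAction k).IsUnital := by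
  intro x
  have hx : x ∈ Algebra.adjoin k (Set.range (Sweedler.gen k)) := by
    rw [Sweedler.adjoin_gen]
    exact Algebra.mem_top
  induction hx using Algebra.adjoin_induction with
  | mem x hx =>
    obtain ⟨(_ | _), rfl⟩ := hx
    · rw [Sweedler.counit_c]
      exact (sweedlerAction_c k 1 1).trans (by simp)
    · rw [Sweedler.counit_v]
      exact (sweedlerAction_v k 1 1).trans (by simp)
  | algebraMap r => simp [Module.algebraMap_end_apply]
  | add x y _ _ hx hy => rw [map_add, LinearMap.add_apply, hx, hy, map_add, add_smul]
  | mul x y _ _ hx hy =>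
    rw [map_mul, Module.End.mul_apply, hy, map_smul, hx, smul_smul, Bialgebra.counit_mul, mul_comm]

lemma sweedlerAction_cosupp (h2 : ringChar k ≠ 2) :
    (sweedlerAction k).cosupp = (maninDualAction k).cosupp := by
  have h : (2 : k) ≠ 0 := Ring.two_ne_zero h2
  ext f
  rw [mem_maninDualAction_cosupp]
  constructor
  · rintro ⟨x, rfl⟩
    exact ⟨_, (act_eq_triangularOp sweedlerAction_isUnital x).symm⟩
  · rintro ⟨⟨r, s, t⟩, rfl⟩
    -- On `1` and `e`, the operator `x + y c + z v` has triangular coordinates `(x + y, y + z, x -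
    -- y)`; solving for `x`, `y`, `z` requires dividing by `2`.
    refine ⟨((r + t) / 2) • 1 + ((r - t) / 2) • Sweedler.c k +
      (s - (r - t) / 2) • Sweedler.v k, ?_⟩
    change (sweedlerAction k).act _ = _
    refine LinearMap.ext fun ⟨a, b⟩ => ?_
    rw [map_add, map_add, map_smul, map_smul, map_smul, map_one]
    simp only [LinearMap.add_apply, LinearMap.smul_apply, sweedlerAction_c, sweedlerAction_v,
      Module.End.one_apply, triangularOp_apply]
    ext <;> simp <;> field_simp <;> ring

end Cosupports

/-! ### Classification of the cosupports of unital actions -/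

section Classification

variable {k : Type u} [Field k] {H : Type v} [Ring H] [HopfAlgebra k H]
  {ψ : HopfAction k H (k × k)}

lemma HopfAction.isEquivalence_refl_iff {A H₁ H₂ : Type*} [Ring A] [Algebra k A]
    [Semiring H₁] [HopfAlgebra k H₁] [Semiring H₂] [HopfAlgebra k H₂]
    (ψ₁ : HopfAction k H₁ A) (ψ₂ : HopfAction k H₂ A) :
    IsEquivalence ψ₁ ψ₂ AlgEquiv.refl ↔ ψ₁.cosupp = ψ₂.cosupp := by
  have : (((AlgEquiv.refl : A ≃ₐ[k] A).toLinearEquiv.conjAlgEquiv k).toAlgHom) =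
      AlgHom.id k (Module.End k A) := rfl
  rw [IsEquivalence, this, Subalgebra.map_id]

/-- If `γ = ε - 2ξ`, then the operators are combinations of `1` and the swap. -/
lemma act_eq_swapOp (hψ : ψ.IsUnital)
    (h : ∀ x, linCoeff ψ x = Coalgebra.counit (R := k) x - 2 * constCoeff ψ x) (x : H) :
    ψ.act x = swapOp k (Coalgebra.counit (R := k) x - constCoeff ψ x, constCoeff ψ x) := by
  -- Here `ξ 1 + (ε - 2ξ) e = (ε - ξ) e + ξ (1 - e)`, and `1 - e` is the swap of `e`.
  rw [act_eq_triangularOp hψ, swapOp_eq_triangularOp, h]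
  congr 3
  · ring
  · ring_nf

lemma cosupp_eq_trivial_or_swap (hψ : ψ.IsUnital)
    (h : ∀ x, linCoeff ψ x = Coalgebra.counit (R := k) x - 2 * constCoeff ψ x) :
    ψ.cosupp = (trivialAction k).cosupp ∨ ψ.cosupp = (swapAction k).cosupp := by
  by_cases h0 : ∀ x, constCoeff ψ x = 0
  · left
    rw [trivialAction_cosupp, eq_bot_iff]
    rintro _ ⟨x, rfl⟩
    refine mem_trivialAction_cosupp.2 ⟨Coalgebra.counit x, ?_⟩
    exact (act_eq_swapOp hψ h x).trans (by simp [h0, swapOp_apply])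
  · right
    push Not at h0
    obtain ⟨y, hy⟩ := h0
    -- Where `ξ(y) ≠ 0`, the swap is recovered from the operator of `y` by subtracting a scalar and
    -- dividing by `ξ(y)`.
    have hs : swap k ∈ ψ.cosupp := by
      have h1 : ψ.act y ∈ ψ.cosupp := ⟨y, rfl⟩
      rw [act_eq_swapOp hψ h, swapOp_apply] at h1
      have h2 := ψ.cosupp.smul_mem (ψ.cosupp.sub_mem h1 (ψ.cosupp.smul_mem ψ.cosupp.one_mem
        (Coalgebra.counit (R := k) y - constCoeff ψ y)))
        (constCoeff ψ y)⁻¹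
      simpa [smul_smul, hy] using h2
    ext f
    rw [mem_swapAction_cosupp]
    constructor
    · rintro ⟨x, rfl⟩
      exact ⟨_, (act_eq_swapOp hψ h x).symm⟩
    · rintro ⟨t, rfl⟩
      exact ψ.cosupp.add_mem (ψ.cosupp.smul_mem ψ.cosupp.one_mem _) (ψ.cosupp.smul_mem hs _)

/-- If `ξ` is a multiple of `ε - γ`, then `2ξ = ε - γ`. -/
lemma linCoeff_eq_of_constCoeff_eq_smul (hψ : ψ.IsUnital) {a : k}
    (h : ∀ x, constCoeff ψ x = a * (Coalgebra.counit (R := k) x - linCoeff ψ x)) (x : H) :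
    linCoeff ψ x = Coalgebra.counit (R := k) x - 2 * constCoeff ψ x := by
  have hξ : toConv (constCoeff ψ) = a • ((1 : WithConv (Module.Dual k H)) -
      toConv (linCoeff ψ)) := by
    ext y
    exact h y
  have hγ : toConv (linCoeff ψ) * _ = 1 := AlgHom.toConv_mul_antipode (linCharacter hψ)
  have hrel := constCoeff_linCoeff_rel ψ
  set γ := toConv (linCoeff ψ)
  -- With `ξ = a(1 - γ)`, the relation `ξγ + γξ + γ² = γ` becomes `2a(1 - γ)γ = (1 - γ)γ`, and the
  -- invertible `γ` cancels.
  have h1 : (2 * a) • ((1 : WithConv (Module.Dual k H)) - γ) = 1 - γ := by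
    have h2 : (2 * a) • ((1 - γ) * γ) = (1 - γ) * γ := by
      rw [hξ, smul_mul_assoc, mul_smul_comm, mul_sub, sub_mul, mul_one, one_mul] at hrel
      rw [sub_mul, one_mul, two_mul, add_smul]
      exact eq_sub_of_add_eq hrel
    have h4 := congrArg (fun z => z * toConv ((linCharacter hψ).toLinearMap ∘ₗ
      HopfAlgebra.antipode k)) h2
    simp only [smul_mul_assoc, mul_assoc] at h4
    rwa [hγ, mul_one] at h4
  have h3 : 2 * a * (Coalgebra.counit (R := k) x - linCoeff ψ x) =
      Coalgebra.counit (R := k) x - linCoeff ψ x :=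
    LinearMap.congr_fun (congrArg ofConv h1) x
  rw [h]
  linear_combination h3

/-- If `γ = ε`, then `2ξ = 0`. -/
lemma linCoeff_eq_of_linCoeff_eq_counit
    (h : ∀ x, linCoeff ψ x = Coalgebra.counit (R := k) x) (x : H) :
    linCoeff ψ x = Coalgebra.counit (R := k) x - 2 * constCoeff ψ x := by
  have hγ : toConv (linCoeff ψ) = (1 : WithConv (Module.Dual k H)) := by
    ext y
    exact h y
  have hrel := constCoeff_linCoeff_rel ψ
  rw [hγ, mul_one, one_mul, mul_one, add_eq_right] at hrel
  have h1 : constCoeff ψ x + constCoeff ψ x = 0 := LinearMap.congr_fun (congrArg ofConv hrel) x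
  rw [h]
  linear_combination h1

/-- The dichotomy is whether `ε`, `ξ`, `γ` are linearly independent. A single nontrivial linear
relation already forces `γ = ε - 2ξ`, so the cosupport cannot be any other subspace of the
triangular operators. -/
theorem cosupp_classification (hψ : ψ.IsUnital) :
    ψ.cosupp = (trivialAction k).cosupp ∨ ψ.cosupp = (swapAction k).cosupp ∨
      ψ.cosupp = (maninDualAction k).cosupp := by
  let L : H →ₗ[k] k × k × k :=
    (Coalgebra.counit (R := k) (A := H)).prod ((constCoeff ψ).prod (linCoeff ψ))
  have hL : ∀ x, ψ.act x = triangularOp k (L x) := act_eq_triangularOp hψ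
  by_cases hsurj : LinearMap.range L = ⊤
  · right; right
    ext f
    rw [mem_maninDualAction_cosupp]
    constructor
    · rintro ⟨x, rfl⟩
      exact ⟨_, (hL x).symm⟩
    · rintro ⟨t, rfl⟩
      obtain ⟨x, rfl⟩ := LinearMap.range_eq_top.1 hsurj t
      exact ⟨x, hL x⟩
  · rw [← or_assoc]
    left
    apply cosupp_eq_trivial_or_swap hψ
    -- A proper subspace of `k³` is killed by a nonzero functional; its coefficients give `aε + bξ +
    -- cγ = 0`.
    obtain ⟨p, hp, hle⟩ := Submodule.exists_le_ker_of_lt_top _ (lt_top_iff_ne_top.2 hsurj)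
    set a := p (1, 0, 0)
    set b := p (0, 1, 0)
    set c := p (0, 0, 1)
    have hp' : ∀ r s t, p (r, s, t) = r * a + s * b + t * c := by
      intro r s t
      have : ((r, s, t) : k × k × k) = r • (1, 0, 0) + s • (0, 1, 0) + t • (0, 0, 1) := by simp
      rw [this, map_add, map_add, map_smul, map_smul, map_smul]
      rfl
    have h0 : ∀ x, Coalgebra.counit (R := k) x * a + constCoeff ψ x * b + linCoeff ψ x * c = 0 :=
      fun x => (hp' _ _ _).symm.trans (hle ⟨x, rfl⟩)
    -- Evaluation at `1 ∈ H`, where `ε`, `ξ`, `γ` take the values `1`, `0`, `1`.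
    have hac : a + c = 0 := by
      have := h0 1
      simpa [constCoeff, linCoeff] using this
    obtain hb | hb := eq_or_ne b 0
    · have ha : a ≠ 0 := by
        intro ha
        apply hp
        refine LinearMap.ext fun ⟨r, s, t⟩ => ?_
        have hc : c = 0 := by rwa [ha, zero_add] at hac
        rw [hp', ha, hb, hc]
        simp
      refine linCoeff_eq_of_linCoeff_eq_counit fun x => mul_left_cancel₀ ha ?_
      linear_combination linCoeff ψ x * hac - h0 x + constCoeff ψ x * hb
    -- As `c = -a`, the relation reads `bξ = -a(ε - γ)`.
    · refine linCoeff_eq_of_constCoeff_eq_smul hψ (a := -a / b) fun x => ?_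
      field_simp
      linear_combination h0 x - linCoeff ψ x * hac

end Classification

/-! ### Universality of the trivial action and of the swap action -/

section Universality

variable {k : Type u} [Field k] {H : Type v} [Ring H] [HopfAlgebra k H]
  {ψ : HopfAction k H (k × k)}

/-- A unital action by scalars is an action through the counit, and the effect on `1` identifies any
other candidate with the counit. -/
lemma existsUnique_bialgHom_trivial (h : ψ.cosupp ≤ (trivialAction k).cosupp) :
    ∃! φ : H →ₐc[k] k, ∀ (x : H) (a : k × k), (trivialAction k).act (φ x) a = ψ.act x a := by
  have hact : ∀ (r : k) (a : k × k), (trivialAction k).act r a = r • a := fun _ _ => rfl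
  have hψ : ψ.IsUnital := ψ.isUnital_of_eigenvector (AlgHom.snd k k k) fun x => by
    obtain ⟨r, hr⟩ := h ⟨x, rfl⟩
    exact ⟨r, (LinearMap.congr_fun hr 1).symm⟩
  refine ⟨Bialgebra.counitBialgHom k H, fun x a => ?_, fun φ hφ => ?_⟩
  · obtain ⟨r, hr⟩ := h ⟨x, rfl⟩
    have hr : ∀ a, r • a = ψ.act x a := LinearMap.congr_fun hr
    have h1 := hψ x
    rw [← hr] at h1
    rw [hact, ← hr]
    have h2 : r = Coalgebra.counit (R := k) x := by simpa [Prod.ext_iff] using h1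
    rw [h2]
    rfl
  · refine DFunLike.ext _ _ fun x => ?_
    have h1 := hφ x 1
    rw [hψ, hact] at h1
    have h2 : φ x = Coalgebra.counit (R := k) x := by simpa [Prod.ext_iff] using h1
    exact h2

variable (k) in
/-- A linear retraction of `k C₂ → End (k × k)`. -/
def swapRetraction : Module.End k (k × k) →ₗ[k] MonoidAlgebra k C2 :=
  ((LinearMap.fst k k k).smulRight (MonoidAlgebra.of k C2 1) +
    (LinearMap.snd k k k).smulRight (MonoidAlgebra.of k C2 C2.c)) ∘ₗ LinearMap.applyₗ (1, 0)

/-- `α + βc` sends `e` to `(α, β)`, so an element of `k C₂` is recovered from the value of its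
operator at `e`. In particular `ψ₂` is faithful, which gives both existence and uniqueness of the
comparison map. -/
lemma swapRetraction_act (x : MonoidAlgebra k C2) :
    swapRetraction k ((swapAction k).act x) = x := by
  obtain ⟨α, β, rfl⟩ := monoidAlgebra_C2_eq x
  rw [swapAction_act_one_add]
  simp [swapRetraction, swapOp_apply_apply]

lemma act_swapRetraction {f : Module.End k (k × k)} (hf : f ∈ (swapAction k).cosupp) :
    (swapAction k).act (swapRetraction k f) = f := by
  obtain ⟨x, rfl⟩ := hf
  exact congrArg (swapAction k).act (swapRetraction_act x)

/-- The algebra homomorphism `H → k C₂` given by an action with cosupport in that of the swap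
action. -/
def swapAlgHom (h : ψ.cosupp ≤ (swapAction k).cosupp) : H →ₐ[k] MonoidAlgebra k C2 :=
  AlgHom.ofLinearMap (swapRetraction k ∘ₗ ψ.act.toLinearMap)
    (by
      have := swapRetraction_act (1 : MonoidAlgebra k C2)
      rw [map_one] at this
      simpa using this)
    (by
      intro x y
      change swapRetraction k (ψ.act (x * y)) =
        swapRetraction k (ψ.act x) * swapRetraction k (ψ.act y)
      rw [map_mul]
      -- Both operators lie in the image of `k C₂`, and on that image the retraction is the inverse
      -- of an algebra homomorphism.
      nth_rewrite 1 [← act_swapRetraction (h ⟨x, rfl⟩ : ψ.act x ∈ _),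
        ← act_swapRetraction (h ⟨y, rfl⟩ : ψ.act y ∈ _)]
      rw [← map_mul, swapRetraction_act])

lemma act_swapAlgHom (h : ψ.cosupp ≤ (swapAction k).cosupp) (x : H) :
    (swapAction k).act (swapAlgHom h x) = ψ.act x :=
  act_swapRetraction (h ⟨x, rfl⟩)

lemma swapAlgHom_toLinearMap (h : ψ.cosupp ≤ (swapAction k).cosupp) :
    (swapAlgHom h).toLinearMap =
      (ψ.coeff (LinearMap.fst k k k) (1, 0)).smulRight (MonoidAlgebra.of k C2 1) +
      (ψ.coeff (LinearMap.snd k k k) (1, 0)).smulRight (MonoidAlgebra.of k C2 C2.c) := rfl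

/-- The operator `α + βc` multiplies `1` by `α + β`, which unitality identifies with the counit. -/
lemma coeff_fst_add_coeff_snd (hψ : ψ.IsUnital) (h : ψ.cosupp ≤ (swapAction k).cosupp) :
    toConv (ψ.coeff (LinearMap.fst k k k) (1, 0)) + toConv (ψ.coeff (LinearMap.snd k k k) (1, 0)) =
      (1 : WithConv (Module.Dual k H)) := by
  ext x
  obtain ⟨t, ht⟩ := mem_swapAction_cosupp.1 (h ⟨x, rfl⟩)
  have ht : ∀ a, swapOp k t a = ψ.act x a := LinearMap.congr_fun ht
  have h1 := hψ x
  change (ψ.act x (1, 0)).1 + (ψ.act x (1, 0)).2 = Coalgebra.counit (R := k) x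
  rw [← ht, swapOp_apply_apply] at h1 ⊢
  simp only [Prod.ext_iff] at h1
  simpa using h1.1

/-- The bialgebra homomorphism `H → k C₂` given by an action with cosupport in that of the swap
action. -/
def swapBialgHom (hψ : ψ.IsUnital) (h : ψ.cosupp ≤ (swapAction k).cosupp) :
    H →ₐc[k] MonoidAlgebra k C2 :=
  BialgHom.ofAlgHom (swapAlgHom h)
    (by
      apply AlgHom.toLinearMap_injective
      rw [AlgHom.comp_toLinearMap, swapAlgHom_toLinearMap]
      ext x
      have h1 := LinearMap.congr_fun (congrArg ofConv (coeff_fst_add_coeff_snd hψ h)) x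
      refine Eq.trans ?_ h1
      simp)
    (by
      apply AlgHom.toLinearMap_injective
      ext x
      change TensorProduct.map (swapAlgHom h).toLinearMap (swapAlgHom h).toLinearMap
        (Coalgebra.comul (R := k) x) = Coalgebra.comul ((swapAlgHom h).toLinearMap x)
      have hα := conv_fst_mul ψ (1, 0) (1, 0)
      have hβ := conv_snd_mul ψ (1, 0) (1, 0)
      rw [Prod.mk_mul_mk, one_mul, zero_mul] at hα hβ
      have hsum := coeff_fst_add_coeff_snd hψ h
      rw [swapAlgHom_toLinearMap]
      simp only [TensorProduct.map_add_left, TensorProduct.map_add_right, LinearMap.add_apply,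
        map_smulRight_comul]
      set α := toConv (ψ.coeff (LinearMap.fst k k k) (1, 0)) with hαdef
      set β := toConv (ψ.coeff (LinearMap.snd k k k) (1, 0)) with hβdef
      -- Complementary idempotents are orthogonal. The mixed terms `αβ 1 ⊗ c` and `βα c ⊗ 1`
      -- therefore vanish, leaving `α 1 ⊗ 1 + β c ⊗ c`, the comultiplication of the group algebra.
      have hβα : β = 1 - α := eq_sub_of_add_eq' hsum
      have h1 : α * β = 0 := by rw [hβα, mul_sub, mul_one, ← hα, sub_self]
      have h2 : β * α = 0 := by rw [hβα, sub_mul, one_mul, ← hα, sub_self]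
      rw [h1, h2, ← hα, ← hβ]
      simp [hαdef, hβdef, ← TensorProduct.tmul_smul])

lemma existsUnique_bialgHom_swap (h : ψ.cosupp ≤ (swapAction k).cosupp) :
    ∃! φ : H →ₐc[k] MonoidAlgebra k C2,
      ∀ (x : H) (a : k × k), (swapAction k).act (φ x) a = ψ.act x a := by
  have hψ : ψ.IsUnital := isUnital_of_cosupp_le_triangular fun _ hf =>
    range_swapOp_le (mem_swapAction_cosupp.1 (h hf))
  refine ⟨swapBialgHom hψ h, fun x a => LinearMap.congr_fun (act_swapAlgHom h x) a,
    fun φ hφ => ?_⟩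
  refine DFunLike.ext _ _ fun x => ?_
  have h1 : (swapAction k).act (φ x) = ψ.act x := LinearMap.ext (hφ x)
  rw [← swapRetraction_act (φ x), h1]
  rfl

end Universality

end HopfSym

end

open HopfSym HopfSym.HopfAction in
theorem mainTheorem6 (k : Type u) [Field k] :
    -- every unital action is equivalent (via the identity) to one of the three actions
    (∀ (H : Type v) [Ring H] [HopfAlgebra k H] (ψ : HopfAction k H (k × k)), ψ.IsUnital →
      IsEquivalence ψ (trivialAction k) AlgEquiv.refl ∨
      IsEquivalence ψ (swapAction k) AlgEquiv.refl ∨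
      IsEquivalence ψ (maninDualAction k) AlgEquiv.refl) ∧
    -- the trivial action
    ((trivialAction k).IsUnital ∧
      Module.finrank k (trivialAction k).cosupp = 1 ∧
      (∀ f : Module.End k (k × k), f ∈ (trivialAction k).cosupp ↔ ∃ r : k, f = r • 1)) ∧
    -- the swap action
    ((swapAction k).IsUnital ∧
      Module.finrank k (swapAction k).cosupp = 2 ∧
      (∀ h2 : ringChar k ≠ 2, ∀ f : Module.End k (k × k), f ∈ (swapAction k).cosupp ↔
        (LinearMap.toMatrix (basisPlusMinus h2) (basisPlusMinus h2) f).IsDiag) ∧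
      (ringChar k = 2 → ∀ f : Module.End k (k × k), f ∈ (swapAction k).cosupp ↔
        ∃ α β : k, LinearMap.toMatrix (basisOneE k) (basisOneE k) f = !![α, β; 0, α])) ∧
    -- the action dual to the Manin coaction
    ((maninDualAction k).IsUnital ∧
      Module.finrank k (maninDualAction k).cosupp = 3 ∧
      (∀ f : Module.End k (k × k), f ∈ (maninDualAction k).cosupp ↔
        (LinearMap.toMatrix (basisOneE k) (basisOneE k) f).BlockTriangular id) ∧
      (ringChar k ≠ 2 → (sweedlerAction k).IsUnital ∧
        IsEquivalence (sweedlerAction k) (maninDualAction k) AlgEquiv.refl)) ∧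
    -- universality
    (IsUniversal.{v} (trivialAction k) (trivialAction k).cosupp ∧
      IsUniversal.{v} (swapAction k) (swapAction k).cosupp ∧
      IsUniversal.{v} (maninDualAction k) (maninDualAction k).cosupp) := by
  refine ⟨fun H _ _ ψ hψ => ?_,
    ⟨trivialAction_isUnital, by rw [trivialAction_cosupp]; exact Subalgebra.finrank_bot,
      fun f => mem_trivialAction_cosupp⟩,
    ⟨swapAction_isUnital, finrank_swapAction_cosupp,
      fun h2 f => mem_swapAction_cosupp.trans (isDiag_toMatrix_basisPlusMinus_iff h2).symm,
      fun h2 f => mem_swapAction_cosupp.trans (mem_range_swapOp_iff_of_ringChar_eq_two h2)⟩,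
    ⟨maninDualAction_isUnital, finrank_maninDualAction_cosupp,
      fun f => mem_maninDualAction_cosupp.trans blockTriangular_toMatrix_basisOneE_iff.symm,
      fun h2 => ⟨sweedlerAction_isUnital,
        (isEquivalence_refl_iff _ _).2 (sweedlerAction_cosupp h2)⟩⟩,
    ⟨le_rfl, fun H _ _ ψ hψ => existsUnique_bialgHom_trivial hψ⟩,
    ⟨le_rfl, fun H _ _ ψ hψ => existsUnique_bialgHom_swap hψ⟩,
    ⟨le_rfl, fun H _ _ ψ hψ => existsUnique_bialgHom_maninDual
      (isUnital_of_cosupp_le_triangular fun f hf => mem_maninDualAction_cosupp.1 (hψ hf))⟩⟩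
  simp only [isEquivalence_refl_iff]
  exact cosupp_classification hψ
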